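/- Let $E/\mathbb{Q}$ be an elliptic curve. For a prime $p$ let $E_0(\mathbb{Q}_p)\subseteq E(\mathbb{Q}_p)$ be the subgroup of points with nonsingular reduction on a minimal Weierstrass equation of $E$ over $\mathbb{Z}_p$, and let $c_p(E)=[E(\mathbb{Q}_p):E_0(\mathbb{Q}_p)]$. Put $c(E)=\prod_p c_p(E)$, the product being over the primes $p$ of bad reduction of $E$, and let $c_\infty(E)=2$ if the discriminant of $E$ is positive and $c_\infty(E)=1$ if it is negative. If $E$ has a $\mathbb{Q}$-rational point of order $4$, then $4$ divides $c(E)\cdot c_\infty(E)$, except when $E$ is isomorphic over $\mathbb{Q}$ to one of the following five curves (given with their Cremona labels): - 15a7: $y^2+xy+y=x^3+x^2-80x+242$, - 15a8: $y^2+xy+y=x^3+x^2$, - 17a4: $y^2+xy+y=x^3-x^2-x$, - 21a4: $y^2+xy=x^3+x$, - 24a4: $y^2=x^3-x^2+x$. Each of these five curves is a genuine exception: it has a $\mathbb{Q}$-rational point of order $4$, and $4$ does not divide $c(E)\cdot c_\infty(E)$. -/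

import Mathlib

namespace WeierstrassCurve

section LocalHelpers

variable {K Γ : Type*} [Field K] [LinearOrderedCommGroupWithZero Γ] (v : Valuation K Γ)

/-- Valuation-theoretic form of "the affine point `(x, y)` is integral and reduces to a singular
point": the coordinates are integral and both partial derivatives vanish in the residue field. -/
def SingularAt (W : WeierstrassCurve K) (x y : K) : Prop :=
  v x ≤ 1 ∧ v y ≤ 1 ∧ v (W.a₁ * y - (3 * x ^ 2 + 2 * W.a₂ * x + W.a₄)) < 1 ∧
    v (2 * y + W.a₁ * x + W.a₃) < 1

theorem valuation_natCast_le_one (n : ℕ) : v (n : K) ≤ 1 := by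
  induction n with
  | zero => simp
  | succ n ih => push_cast; exact v.map_add_le ih (by simp)

theorem val_mul_lt {a b : K} (ha : v a ≤ 1) (hb : v b < 1) : v (a * b) < 1 := by
  rw [map_mul]; exact mul_lt_one_of_nonneg_of_lt_one_right ha zero_le hb

theorem val_mul_le {a b : K} (ha : v a ≤ 1) (hb : v b ≤ 1) : v (a * b) ≤ 1 := by
  rw [map_mul]; exact mul_le_one' ha hb

theorem singularAt_neg {W : WeierstrassCurve K} (h1 : v W.a₁ ≤ 1) (h3 : v W.a₃ ≤ 1)
    {x y : K} (h : SingularAt v W x y) : SingularAt v W x (W.toAffine.negY x y) := by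
  obtain ⟨hx, hy, hX, hY⟩ := h
  have e1 : W.a₁ * W.toAffine.negY x y - (3 * x ^ 2 + 2 * W.a₂ * x + W.a₄) =
      (W.a₁ * y - (3 * x ^ 2 + 2 * W.a₂ * x + W.a₄)) -
        W.a₁ * (2 * y + W.a₁ * x + W.a₃) := by
    simp only [Affine.negY]; ring
  have e2 : 2 * W.toAffine.negY x y + W.a₁ * x + W.a₃ = -(2 * y + W.a₁ * x + W.a₃) := by
    simp only [Affine.negY]; ring
  refine ⟨hx, ?_, ?_, ?_⟩
  · rw [Affine.negY]
    exact v.map_sub_le (v.map_sub_le (by rwa [Valuation.map_neg]) (val_mul_le v h1 hx)) h3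
  · rw [e1]
    exact v.map_sub_lt hX (val_mul_lt v h1 hY)
  · rwa [e2, Valuation.map_neg]

/-- A point congruent to a point with singular reduction has the same singular reduction. -/
theorem singularAt_congr {W : WeierstrassCurve K} (h1 : v W.a₁ ≤ 1) (h2 : v W.a₂ ≤ 1)
    {x y a b : K} (h : SingularAt v W x y) (ha : v a < 1) (hb : v b < 1) :
    SingularAt v W (x + a) (y + b) := by
  obtain ⟨hx, hy, hX, hY⟩ := h
  have n2 : v (2 : K) ≤ 1 := by exact_mod_cast valuation_natCast_le_one v 2
  have n3 : v (3 : K) ≤ 1 := by exact_mod_cast valuation_natCast_le_one v 3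
  have e1 : W.a₁ * (y + b) - (3 * (x + a) ^ 2 + 2 * W.a₂ * (x + a) + W.a₄) =
      (W.a₁ * y - (3 * x ^ 2 + 2 * W.a₂ * x + W.a₄)) + W.a₁ * b
        - (3 * (2 * x + a) + 2 * W.a₂) * a := by ring
  have e2 : 2 * (y + b) + W.a₁ * (x + a) + W.a₃ =
      (2 * y + W.a₁ * x + W.a₃) + 2 * b + W.a₁ * a := by ring
  refine ⟨v.map_add_le hx ha.le, v.map_add_le hy hb.le, ?_, ?_⟩
  · rw [e1]
    refine v.map_sub_lt (v.map_add_lt hX (val_mul_lt v h1 hb)) (val_mul_lt v ?_ ha)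
    exact v.map_add_le (val_mul_le v n3 (v.map_add_le (val_mul_le v n2 hx) ha.le))
      (val_mul_le v n2 h2)
  · rw [e2]
    exact v.map_add_lt (v.map_add_lt hY (val_mul_lt v n2 hb)) (val_mul_lt v h1 ha)

/-- If a line meets the curve in the affine points `(x₁, y₁)`, `(x₂, y₂)`, `(x, y)` and the last one
has singular reduction, then so does one of the others. -/
theorem singularAt_of_line {W : WeierstrassCurve K} (h1 : v W.a₁ ≤ 1) (h2 : v W.a₂ ≤ 1)
    {x y x₁ y₁ x₂ y₂ l : K} (h : SingularAt v W x y)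
    (hE : W.toAffine.Equation x y) (hE₁ : W.toAffine.Equation x₁ y₁)
    (hy₁ : y₁ = y + l * (x₁ - x)) (hy₂ : y₂ = y + l * (x₂ - x))
    (hx : x = l ^ 2 + W.a₁ * l - W.a₂ - x₁ - x₂) :
    SingularAt v W x₁ y₁ ∨ SingularAt v W x₂ y₂ := by
  have n3 : v (3 : K) ≤ 1 := by exact_mod_cast valuation_natCast_le_one v 3
  obtain ⟨hxi, hyi, hX, hY⟩ := id h
  rw [Affine.equation_iff] at hE hE₁
  obtain ⟨u₁, hu₁⟩ : ∃ u, u = x₁ - x := ⟨_, rfl⟩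
  obtain ⟨u₂, hu₂⟩ : ∃ u, u = x₂ - x := ⟨_, rfl⟩
  set B := 3 * x + W.a₂ with hB
  set C := W.a₁ * y - (3 * x ^ 2 + 2 * W.a₂ * x + W.a₄) with hC
  set D := 2 * y + W.a₁ * x + W.a₃ with hD
  have hBi : v B ≤ 1 := v.map_add_le (val_mul_le v n3 hxi) h2
  have hsum : u₁ + u₂ = l ^ 2 + W.a₁ * l - B := by
    rw [hu₁, hu₂, hB]; linear_combination hx
  -- it is enough that one of the two differences has both coordinates small
  have key : (v u₁ < 1 ∧ v (l * u₁) < 1) ∨ (v u₂ < 1 ∧ v (l * u₂) < 1) := by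
    by_cases hu0 : u₁ = 0
    · left; simp [hu0]
    have hprod : u₁ * u₂ = -(D * l + C) := by
      have : u₁ * (u₁ * u₂ + (D * l + C)) = 0 := by
        have e2 : u₂ = l ^ 2 + W.a₁ * l - B - u₁ := by linear_combination hsum
        have ex : x₁ = x + u₁ := by rw [hu₁]; ring
        rw [hy₁, ex] at hE₁
        rw [e2, hB, hC, hD]
        linear_combination hE₁ - hE
      rcases mul_eq_zero.mp this with h0 | h0
      · exact absurd h0 hu0
      · linear_combination h0
    by_cases hl : v l ≤ 1
    · have hp : v (u₁ * u₂) < 1 := by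
        rw [hprod, Valuation.map_neg, mul_comm]
        exact v.map_add_lt (val_mul_lt v hl hY) hX
      have : v u₁ < 1 ∨ v u₂ < 1 := by
        by_contra! hc
        rw [map_mul] at hp
        exact absurd hp (not_lt.mpr (one_le_mul hc.1 hc.2))
      rcases this with h' | h'
      · exact Or.inl ⟨h', val_mul_lt v hl h'⟩
      · exact Or.inr ⟨h', val_mul_lt v hl h'⟩
    · have hl' : 1 < v l := not_le.mp hl
      have hl0 : l ≠ 0 := by rintro rfl; simp at hl'
      obtain ⟨k, hk⟩ : ∃ k, k = l⁻¹ := ⟨_, rfl⟩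
      have hk1 : v k < 1 := by
        rw [hk, map_inv₀]; exact inv_lt_one_of_one_lt₀ hl'
      have hkl : k * l = 1 := by rw [hk]; exact inv_mul_cancel₀ hl0
      obtain ⟨w₁, hw₁⟩ : ∃ w, w = l * u₁ := ⟨_, rfl⟩
      obtain ⟨w₂, hw₂⟩ : ∃ w, w = l * u₂ := ⟨_, rfl⟩
      have hs : k ^ 3 * (w₁ + w₂) = 1 + (W.a₁ - B * k) * k := by
        have : k ^ 3 * (w₁ + w₂) = k ^ 2 * (k * l) * (u₁ + u₂) := by rw [hw₁, hw₂]; ring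
        rw [this, hsum, hkl]
        linear_combination (k * l + 1 + W.a₁ * k) * hkl
      have hp : k ^ 3 * (w₁ * w₂) = -(D + C * k) := by
        have : k ^ 3 * (w₁ * w₂) = k * (k * l) ^ 2 * (u₁ * u₂) := by rw [hw₁, hw₂]; ring
        rw [this, hprod, hkl]
        linear_combination (-D) * hkl
      have hsv : v (k ^ 3 * (w₁ + w₂)) = 1 := by
        rw [hs, Valuation.map_one_add_of_lt]
        exact val_mul_lt v (v.map_sub_le h1 (val_mul_le v hBi hk1.le)) hk1
      have hpv : v (k ^ 3 * (w₁ * w₂)) < 1 := by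
        rw [hp, Valuation.map_neg]
        exact v.map_add_lt hY (val_mul_lt v hX.le hk1)
      have hw : v w₁ < 1 ∨ v w₂ < 1 := by
        by_contra! hc
        have h3 : v (w₁ + w₂) ≤ v (w₁ * w₂) := by
          refine (v.map_add _ _).trans (max_le ?_ ?_)
          · rw [map_mul]; exact le_mul_of_one_le_right' hc.2
          · rw [map_mul]; exact le_mul_of_one_le_left' hc.1
        rw [map_mul] at hsv hpv
        exact absurd (hsv ▸ mul_le_mul_right h3 (v (k ^ 3))) (not_le.mpr hpv)
      have back : ∀ u w : K, w = l * u → v w < 1 → v u < 1 := by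
        intro u w hwu hw1
        have : u = k * w := by rw [hwu, ← mul_assoc, hkl, one_mul]
        rw [this]; exact val_mul_lt v hk1.le hw1
      rcases hw with h' | h'
      · exact Or.inl ⟨back _ _ hw₁ h', hw₁ ▸ h'⟩
      · exact Or.inr ⟨back _ _ hw₂ h', hw₂ ▸ h'⟩
  rcases key with ⟨ha, hb⟩ | ⟨ha, hb⟩
  · left
    have := singularAt_congr v h1 h2 h ha hb
    rwa [hu₁, ← hy₁, add_sub_cancel] at this
  · right
    have := singularAt_congr v h1 h2 h ha hb
    rwa [hu₂, ← hy₂, add_sub_cancel] at this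

end LocalHelpers

section Local

variable (R : Type*) [CommRing R] [IsDomain R] [IsDiscreteValuationRing R]
variable {K : Type*} [Field K] [Algebra R K] [IsFractionRing R K]

/-- A `K`-point of a minimal Weierstrass equation has nonsingular reduction: the point at infinity
does, and an affine point does unless its coordinates are integral and it reduces to a singular
point of the reduced curve. (An affine point with a non-integral coordinate reduces to the point at
infinity, which is nonsingular.) -/
def HasNonsingularReduction (W : WeierstrassCurve K) [IsMinimal R W] : W.toAffine.Point → Prop
  | .zero => True
  | .some x y _ => ∀ x₀ y₀ : R, algebraMap R K x₀ = x → algebraMap R K y₀ = y →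
      (W.reduction R).toAffine.Nonsingular (IsLocalRing.residue R x₀) (IsLocalRing.residue R y₀)

open IsDedekindDomain.HeightOneSpectrum in
theorem hasNonsingularReduction_some_iff (W : WeierstrassCurve K) [IsMinimal R W] {x y : K}
    (h : W.toAffine.Nonsingular x y) :
    HasNonsingularReduction R W (.some x y h) ↔
      ¬ SingularAt (valuation K (IsDiscreteValuationRing.maximalIdeal R)) W x y := by
  set v := valuation K (IsDiscreteValuationRing.maximalIdeal R) with hv
  have hlt : ∀ r : R, v (algebraMap R K r) < 1 ↔ IsLocalRing.residue R r = 0 := by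
    intro r
    rw [IsLocalRing.residue_eq_zero_iff]
    exact valuation_lt_one_iff_mem (K := K) (IsDiscreteValuationRing.maximalIdeal R) r
  have hint : ∀ z : K, v z ≤ 1 → ∃ r : R, algebraMap R K r = z := fun z hz =>
    IsDiscreteValuationRing.exists_lift_of_le_one hz
  have main : ∀ x₀ y₀ : R, algebraMap R K x₀ = x → algebraMap R K y₀ = y →
      ((W.reduction R).toAffine.Nonsingular (IsLocalRing.residue R x₀)
        (IsLocalRing.residue R y₀) ↔ ¬ SingularAt v W x y) := by
    intro x₀ y₀ hx hy
    have hEq : (W.integralModel R).toAffine.Equation x₀ y₀ := by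
      have h' := h.1
      rw [Affine.equation_iff] at h' ⊢
      apply IsFractionRing.injective R K
      simp only [map_add, map_mul, map_pow, integralModel_a₁_eq, integralModel_a₂_eq,
        integralModel_a₃_eq, integralModel_a₄_eq, integralModel_a₆_eq, hx, hy]
      exact h'
    have hEq' : (W.reduction R).toAffine.Equation (IsLocalRing.residue R x₀)
        (IsLocalRing.residue R y₀) := Affine.Equation.map (IsLocalRing.residue R) hEq
    have eX : W.a₁ * y - (3 * x ^ 2 + 2 * W.a₂ * x + W.a₄) = algebraMap R K
        ((W.integralModel R).a₁ * y₀ - (3 * x₀ ^ 2 + 2 * (W.integralModel R).a₂ * x₀ +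
          (W.integralModel R).a₄)) := by
      simp only [map_add, map_sub, map_mul, map_pow, map_ofNat, integralModel_a₁_eq,
        integralModel_a₂_eq, integralModel_a₄_eq, hx, hy]
    have eY : 2 * y + W.a₁ * x + W.a₃ = algebraMap R K
        (2 * y₀ + (W.integralModel R).a₁ * x₀ + (W.integralModel R).a₃) := by
      simp only [map_add, map_mul, map_ofNat, integralModel_a₁_eq,
        integralModel_a₃_eq, hx, hy]
    have hxi : v x ≤ 1 := hx ▸ valuation_le_one _ x₀
    have hyi : v y ≤ 1 := hy ▸ valuation_le_one _ y₀
    rw [Affine.nonsingular_iff', and_iff_right hEq', SingularAt, eX, eY, hlt, hlt]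
    simp only [hxi, hyi, true_and, reduction, map_a₁, map_a₂, map_a₃, map_a₄, map_add,
      map_sub, map_mul, map_pow, map_ofNat, not_and_or, ne_eq]
  constructor
  · intro H hS
    obtain ⟨x₀, hx⟩ := hint x hS.1
    obtain ⟨y₀, hy⟩ := hint y hS.2.1
    exact (main x₀ y₀ hx hy).mp (H x₀ y₀ hx hy) hS
  · intro H x₀ y₀ hx hy
    exact (main x₀ y₀ hx hy).mpr H

open IsDedekindDomain.HeightOneSpectrum in
open scoped Classical in
/-- The subgroup `E₀(K)` of the points with nonsingular reduction in the group of `K`-points of a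
minimal Weierstrass equation. -/
noncomputable def nonsingularReductionSubgroup (W : WeierstrassCurve K) [IsMinimal R W] :
    AddSubgroup W.toAffine.Point where
  carrier := {P | HasNonsingularReduction R W P}
  zero_mem' := trivial
  neg_mem' := by
    have i1 : valuation K (IsDiscreteValuationRing.maximalIdeal R) W.a₁ ≤ 1 :=
      integralModel_a₁_eq R W ▸ valuation_le_one _ _
    have i3 : valuation K (IsDiscreteValuationRing.maximalIdeal R) W.a₃ ≤ 1 :=
      integralModel_a₃_eq R W ▸ valuation_le_one _ _
    rintro (_ | ⟨x, y, h⟩) hP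
    · exact trivial
    · simp only [Set.mem_ofPred_eq, Affine.Point.neg_some] at hP ⊢
      rw [hasNonsingularReduction_some_iff] at hP ⊢
      intro hS
      apply hP
      have := singularAt_neg _ i1 i3 hS
      rwa [Affine.negY_negY] at this
  add_mem' := by
    have i1 : valuation K (IsDiscreteValuationRing.maximalIdeal R) W.a₁ ≤ 1 :=
      integralModel_a₁_eq R W ▸ valuation_le_one _ _
    have i2 : valuation K (IsDiscreteValuationRing.maximalIdeal R) W.a₂ ≤ 1 :=
      integralModel_a₂_eq R W ▸ valuation_le_one _ _
    have i3 : valuation K (IsDiscreteValuationRing.maximalIdeal R) W.a₃ ≤ 1 :=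
      integralModel_a₃_eq R W ▸ valuation_le_one _ _
    rintro (_ | ⟨x₁, y₁, h₁⟩) (_ | ⟨x₂, y₂, h₂⟩) hP hQ
    · exact trivial
    · simpa only [← Affine.Point.zero_def, zero_add] using hQ
    · simpa only [← Affine.Point.zero_def, add_zero] using hP
    · by_cases hxy : x₁ = x₂ ∧ y₁ = W.toAffine.negY x₂ y₂
      · rw [Affine.Point.add_of_Y_eq hxy.1 hxy.2]
        exact trivial
      · rw [Affine.Point.add_some hxy]
        simp only [Set.mem_ofPred_eq] at hP hQ ⊢
        rw [hasNonsingularReduction_some_iff] at hP hQ ⊢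
        intro hS
        have hS' := singularAt_neg _ i1 i3 hS
        rw [Affine.addY, Affine.negY_negY] at hS'
        set l := W.toAffine.slope x₁ x₂ y₁ y₂ with hl
        have hy : y₂ = y₁ + l * (x₂ - x₁) := by
          by_cases hx : x₁ = x₂
          · subst hx
            have := Affine.Y_eq_of_Y_ne h₁.1 h₂.1 rfl (fun h => hxy ⟨rfl, h⟩)
            rw [this]; ring
          · rw [hl, Affine.slope_of_X_ne hx]
            have : x₁ - x₂ ≠ 0 := sub_ne_zero.mpr hx
            field_simp
            ring
        rcases singularAt_of_line _ (l := l) (y₁ := y₁) (y₂ := y₂) (x₁ := x₁) (x₂ := x₂)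
          i1 i2 hS' (Affine.equation_negAdd h₁.1 h₂.1 hxy) h₁.1
          (by rw [Affine.negAddY]; ring) (by rw [hy, Affine.negAddY]; ring)
          (by rw [Affine.addX]) with h | h
        · exact hP h
        · exact hQ h

open scoped Classical in
/-- The local Tamagawa number `[E(K) : E₀(K)]` of an elliptic curve over the fraction field `K` of
a discrete valuation ring `R`, computed on a minimal Weierstrass equation. -/
noncomputable def localTamagawaNumber (W : WeierstrassCurve K) : ℕ :=
  (nonsingularReductionSubgroup R (W.minimal R)).index

end Local

/-- The Tamagawa number `c_p(E) = [E(ℚ_p) : E₀(ℚ_p)]`. -/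
noncomputable def tamagawaNumberAt (E : WeierstrassCurve ℚ) (p : ℕ) [Fact p.Prime] : ℕ :=
  (E⁄ℚ_[p]).localTamagawaNumber ℤ_[p]

/-- `E` has bad reduction at the prime `p`. -/
def HasBadReductionAt (E : WeierstrassCurve ℚ) (p : ℕ) [Fact p.Prime] : Prop :=
  ¬ ((E⁄ℚ_[p]).minimal ℤ_[p]).HasGoodReduction ℤ_[p]

/-- The Tamagawa number `c(E)`: the product of `c_p(E)` over the (finitely many) primes `p` of bad
reduction. -/
noncomputable def tamagawaNumber (E : WeierstrassCurve ℚ) : ℕ :=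
  ∏ᶠ p : {p : Nat.Primes // haveI := Fact.mk p.2; E.HasBadReductionAt p},
    haveI := Fact.mk p.1.2
    E.tamagawaNumberAt p.1

/-- The Tamagawa number `c_∞(E)` at infinity: `2` if the discriminant is positive, and `1` if it is
negative. -/
def tamagawaNumberAtInfinity (E : WeierstrassCurve ℚ) : ℕ :=
  if 0 < E.Δ then 2 else 1

/-- Two Weierstrass equations over `ℚ` define isomorphic curves over `ℚ`. -/
def IsIsomorphic (E E' : WeierstrassCurve ℚ) : Prop :=
  ∃ C : VariableChange ℚ, C • E = E'

/-- The curve with Cremona label 15a7. -/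
def cremona15a7 : WeierstrassCurve ℚ := ⟨1, 1, 1, -80, 242⟩

/-- The curve with Cremona label 15a8. -/
def cremona15a8 : WeierstrassCurve ℚ := ⟨1, 1, 1, 0, 0⟩

/-- The curve with Cremona label 17a4. -/
def cremona17a4 : WeierstrassCurve ℚ := ⟨1, -1, 1, -1, 0⟩

/-- The curve with Cremona label 21a4. -/
def cremona21a4 : WeierstrassCurve ℚ := ⟨1, 0, 0, 1, 0⟩

/-- The curve with Cremona label 24a4. -/
def cremona24a4 : WeierstrassCurve ℚ := ⟨0, -1, 0, 1, 0⟩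

/-- `E` is isomorphic over `ℚ` to one of the curves 15a7, 15a8, 17a4, 21a4, 24a4. -/
def IsExceptional (E : WeierstrassCurve ℚ) : Prop :=
  E.IsIsomorphic cremona15a7 ∨ E.IsIsomorphic cremona15a8 ∨ E.IsIsomorphic cremona17a4 ∨
    E.IsIsomorphic cremona21a4 ∨ E.IsIsomorphic cremona24a4

/-- `E` has a rational point of order `4`. -/
def HasPointOfOrderFour (E : WeierstrassCurve ℚ) : Prop :=
  ∃ P : E.toAffine.Point, addOrderOf P = 4

end WeierstrassCurve

namespace WeierstrassCurve

/-! ### Points under an admissible change of variables -/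

section VariableChangePoints

variable {F : Type*} [Field F] (C : VariableChange F) (W : WeierstrassCurve F)

/-! A point P of order 4 puts E in Tate normal form y² + αxy + αβy = x³ + βx² with P = (0, 0), 2P =
(-β, 0) and Δ = α²β⁴(α² - 16β). Up to isomorphism only b = β/α² matters
(`exists_variableChange_eq_fourTorsionCurve`).

The divisibility comes from the class of P in E(ℚ_p)/E₀(ℚ_p), on a model minimal at p. If p ∣ β,
then 2P already reduces to a singular point, P has order 4 in the quotient and 4 ∣ c_p. If p ∣ α, at
least P reduces to a singular point and 2 ∣ c_p. A prime in the numerator of b, or one of odd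
exponent in its denominator, gives the first situation. Otherwise b = ±1/k², so α = k and β = ±1: a
prime dividing k gives 2 ∣ c, and c_∞ gives the other factor 2 once Δ = k²(k² ∓ 16) is positive.
This fails only for β = -1, k = 1 and for β = 1, k = 1, 2, 3, 16 (k = 4 is singular). At k = 16 the
equation is not minimal at 2 and the minimal discriminant is 15. These are the five exceptions.

Tate's algorithm is avoided. An integral equation that no integral substitution shrinks
(`IsReducedModel`) differs from any minimal equation by a unit u and integral r, s, t, so E₀ can be
read off on it (`IsReducedModel.exists_addSubgroup`).

Conversely, three exceptions have squarefree minimal discriminant, so c = 1. For k = 2, 3 one has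
c_∞ = 1 and c = c_k, and the sum of two points outside E₀ always lies in E₀ (`no_three_collinear`),
so the index is at most 2. -/

theorem equation_variableChange_iff (x y : F) :
    (C • W).toAffine.Equation x y ↔ W.toAffine.Equation (C.u ^ 2 * x + C.r)
      (C.u ^ 3 * y + C.u ^ 2 * C.s * x + C.t) := by
  rw [Affine.equation_iff', Affine.equation_iff']
  have hu : (C.u : F) ≠ 0 := C.u.ne_zero
  simp only [variableChange_def, Units.val_inv_eq_inv_val]
  rw [← mul_right_inj' (pow_ne_zero 6 hu), mul_zero]
  refine Eq.congr_left ?_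
  field_simp
  ring

theorem partialY_variableChange (x y : F) :
    (C.u : F) ^ 3 * (2 * y + (C • W).a₁ * x + (C • W).a₃) =
      2 * (C.u ^ 3 * y + C.u ^ 2 * C.s * x + C.t) + W.a₁ * (C.u ^ 2 * x + C.r) + W.a₃ := by
  have hu : (C.u : F) ≠ 0 := C.u.ne_zero
  simp only [variableChange_def, Units.val_inv_eq_inv_val]
  field_simp
  ring

theorem partialX_variableChange (x y : F) :
    (C.u : F) ^ 4 *
        ((C • W).a₁ * y - (3 * x ^ 2 + 2 * (C • W).a₂ * x + (C • W).a₄)) =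
      W.a₁ * (C.u ^ 3 * y + C.u ^ 2 * C.s * x + C.t) -
        (3 * (C.u ^ 2 * x + C.r) ^ 2 + 2 * W.a₂ * (C.u ^ 2 * x + C.r) + W.a₄) +
        C.s * (2 * (C.u ^ 3 * y + C.u ^ 2 * C.s * x + C.t) + W.a₁ * (C.u ^ 2 * x + C.r) +
          W.a₃) := by
  have hu : (C.u : F) ≠ 0 := C.u.ne_zero
  simp only [variableChange_def, Units.val_inv_eq_inv_val]
  field_simp
  ring

/-- The x-derivative picks up `C.s` times the y-derivative, so the two x-derivatives can be matched
only where the y-derivative vanishes; hence the case split. -/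
theorem nonsingular_variableChange_iff (x y : F) :
    (C • W).toAffine.Nonsingular x y ↔ W.toAffine.Nonsingular (C.u ^ 2 * x + C.r)
      (C.u ^ 3 * y + C.u ^ 2 * C.s * x + C.t) := by
  rw [Affine.nonsingular_iff', Affine.nonsingular_iff', equation_variableChange_iff]
  have hu : (C.u : F) ≠ 0 := C.u.ne_zero
  have e1 := partialY_variableChange C W x y
  have e2 := partialX_variableChange C W x y
  set X := (C.u : F) ^ 2 * x + C.r
  set Y := (C.u : F) ^ 3 * y + C.u ^ 2 * C.s * x + C.t
  have h3 : (2 * y + (C • W).a₁ * x + (C • W).a₃ = 0 ↔ 2 * Y + W.a₁ * X + W.a₃ = 0) := by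
    rw [← e1, mul_eq_zero_iff_left (pow_ne_zero 3 hu)]
  by_cases h0 : 2 * Y + W.a₁ * X + W.a₃ = 0
  · have h4 : ((C • W).a₁ * y - (3 * x ^ 2 + 2 * (C • W).a₂ * x + (C • W).a₄) = 0 ↔
        W.a₁ * Y - (3 * X ^ 2 + 2 * W.a₂ * X + W.a₄) = 0) := by
      rw [← mul_eq_zero_iff_left (pow_ne_zero 4 hu), e2, h0, mul_zero, add_zero]
    simp only [ne_eq, h3, h4]
  · simp only [ne_eq, h3, h0, not_false_eq_true, or_true]

theorem negY_variableChange (x y : F) :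
    W.toAffine.negY (C.u ^ 2 * x + C.r) (C.u ^ 3 * y + C.u ^ 2 * C.s * x + C.t) =
    C.u ^ 3 * (C • W).toAffine.negY x y + C.u ^ 2 * C.s * x + C.t := by
  have hu : (C.u : F) ≠ 0 := C.u.ne_zero
  simp only [Affine.negY, variableChange_def, Units.val_inv_eq_inv_val]
  field_simp
  ring

variable [DecidableEq F]

theorem slope_variableChange {x₁ y₁ x₂ y₂ : F} (h₁ : (C • W).toAffine.Equation x₁ y₁)
    (h₂ : (C • W).toAffine.Equation x₂ y₂) (h : ¬(x₁ = x₂ ∧ y₁ = (C • W).toAffine.negY x₂ y₂)) :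
    W.toAffine.slope (C.u ^ 2 * x₁ + C.r) (C.u ^ 2 * x₂ + C.r)
      (C.u ^ 3 * y₁ + C.u ^ 2 * C.s * x₁ + C.t) (C.u ^ 3 * y₂ + C.u ^ 2 * C.s * x₂ + C.t) =
    C.u * (C • W).toAffine.slope x₁ x₂ y₁ y₂ + C.s := by
  have hu : (C.u : F) ≠ 0 := C.u.ne_zero
  by_cases hx : x₁ = x₂
  · subst hx
    have hy : y₁ ≠ (C • W).toAffine.negY x₁ y₂ := fun h' => h ⟨rfl, h'⟩
    have := Affine.Y_eq_of_Y_ne h₁ h₂ rfl hy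
    subst this
    have hd : y₁ - (C • W).toAffine.negY x₁ y₁ ≠ 0 := sub_ne_zero.mpr hy
    have e1 : (C.u ^ 3 * y₁ + C.u ^ 2 * C.s * x₁ + C.t) -
        W.toAffine.negY (C.u ^ 2 * x₁ + C.r) (C.u ^ 3 * y₁ + C.u ^ 2 * C.s * x₁ + C.t) =
        C.u ^ 3 * (y₁ - (C • W).toAffine.negY x₁ y₁) := by
      simp only [Affine.negY, variableChange_def, Units.val_inv_eq_inv_val]
      field_simp
      ring
    have hy' : (C.u ^ 3 * y₁ + C.u ^ 2 * C.s * x₁ + C.t) ≠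
        W.toAffine.negY (C.u ^ 2 * x₁ + C.r) (C.u ^ 3 * y₁ + C.u ^ 2 * C.s * x₁ + C.t) := by
      rw [← sub_ne_zero, e1]
      exact mul_ne_zero (pow_ne_zero 3 hu) hd
    rw [Affine.slope_of_Y_ne rfl hy', Affine.slope_of_Y_ne rfl hy, e1,
      ← mul_right_inj' (mul_ne_zero (pow_ne_zero 3 hu) hd), mul_div_cancel₀ _
        (mul_ne_zero (pow_ne_zero 3 hu) hd)]
    have e2 : ∀ A D : F, D ≠ 0 → C.u ^ 3 * D * (C.u * (A / D) + C.s) =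
        C.u ^ 4 * A + C.u ^ 3 * D * C.s := by
      intro A D hD
      field_simp
    rw [e2 _ _ hd]
    simp only [Affine.negY, variableChange_def, Units.val_inv_eq_inv_val]
    field_simp
    ring
  · have hx' : (C.u : F) ^ 2 * x₁ + C.r ≠ C.u ^ 2 * x₂ + C.r := fun h' =>
      hx (mul_left_cancel₀ (pow_ne_zero 2 hu) (add_right_cancel h'))
    rw [Affine.slope_of_X_ne hx, Affine.slope_of_X_ne hx', div_eq_iff (sub_ne_zero.mpr hx')]
    have hd : x₁ - x₂ ≠ 0 := sub_ne_zero.mpr hx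
    field_simp
    ring

/-- An admissible change of variables identifies the groups of points. -/
noncomputable def pointVariableChange : (C • W).toAffine.Point →+ W.toAffine.Point where
  toFun
    | .zero => .zero
    | .some x y h => .some _ _ ((nonsingular_variableChange_iff C W x y).mp h)
  map_zero' := rfl
  map_add' := by
    have hu : (C.u : F) ≠ 0 := C.u.ne_zero
    rintro (_ | ⟨x₁, y₁, h₁⟩) (_ | ⟨x₂, y₂, h₂⟩)
    any_goals rfl
    have hiff : (C.u ^ 2 * x₁ + C.r = C.u ^ 2 * x₂ + C.r ∧
        C.u ^ 3 * y₁ + C.u ^ 2 * C.s * x₁ + C.t =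
          W.toAffine.negY (C.u ^ 2 * x₂ + C.r) (C.u ^ 3 * y₂ + C.u ^ 2 * C.s * x₂ + C.t)) ↔
        (x₁ = x₂ ∧ y₁ = (C • W).toAffine.negY x₂ y₂) := by
      rw [negY_variableChange]
      constructor
      · rintro ⟨hx, hy⟩
        have hx' := mul_left_cancel₀ (pow_ne_zero 2 hu) (add_right_cancel hx)
        subst hx'
        refine ⟨rfl, mul_left_cancel₀ (pow_ne_zero 3 hu) ?_⟩
        linear_combination hy
      · rintro ⟨rfl, rfl⟩
        exact ⟨rfl, rfl⟩
    by_cases h : x₁ = x₂ ∧ y₁ = (C • W).toAffine.negY x₂ y₂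
    · rw [Affine.Point.add_of_Y_eq h.1 h.2]
      exact (Affine.Point.add_of_Y_eq (hiff.mpr h).1 (hiff.mpr h).2).symm
    · rw [Affine.Point.add_some h]
      refine Eq.trans ?_ (Affine.Point.add_some (mt hiff.mp h)).symm
      have hX : (C.u : F) ^ 2 * (C • W).toAffine.addX x₁ x₂ ((C • W).toAffine.slope x₁ x₂ y₁ y₂) +
          C.r = W.toAffine.addX (C.u ^ 2 * x₁ + C.r) (C.u ^ 2 * x₂ + C.r)
            (C.u * (C • W).toAffine.slope x₁ x₂ y₁ y₂ + C.s) := by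
        generalize (C • W).toAffine.slope x₁ x₂ y₁ y₂ = l
        simp only [Affine.addX, variableChange_def, Units.val_inv_eq_inv_val]
        field_simp
        ring
      have hY : (C.u : F) ^ 3 *
          (C • W).toAffine.addY x₁ x₂ y₁ ((C • W).toAffine.slope x₁ x₂ y₁ y₂) +
          C.u ^ 2 * C.s * (C • W).toAffine.addX x₁ x₂ ((C • W).toAffine.slope x₁ x₂ y₁ y₂) +
          C.t = W.toAffine.addY (C.u ^ 2 * x₁ + C.r) (C.u ^ 2 * x₂ + C.r)
            (C.u ^ 3 * y₁ + C.u ^ 2 * C.s * x₁ + C.t)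
            (C.u * (C • W).toAffine.slope x₁ x₂ y₁ y₂ + C.s) := by
        generalize (C • W).toAffine.slope x₁ x₂ y₁ y₂ = l
        simp only [Affine.addY, Affine.negAddY, Affine.negY, Affine.addX, variableChange_def,
          Units.val_inv_eq_inv_val]
        field_simp
        ring
      rw [Affine.Point.some.injEq, slope_variableChange C W h₁.1 h₂.1 h]
      exact ⟨hX, hY⟩

theorem pointVariableChange_some {x y : F} (h : (C • W).toAffine.Nonsingular x y) :
    pointVariableChange C W (.some x y h) =
      .some _ _ ((nonsingular_variableChange_iff C W x y).mp h) := rfl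

theorem pointVariableChange_injective : Function.Injective (pointVariableChange C W) := by
  rw [injective_iff_map_eq_zero]
  rintro (_ | ⟨x, y, h⟩) h0
  · rfl
  · rw [pointVariableChange_some] at h0
    exact absurd h0 (Affine.Point.some_ne_zero _)

theorem pointVariableChange_surjective : Function.Surjective (pointVariableChange C W) := by
  have hu : (C.u : F) ≠ 0 := C.u.ne_zero
  rintro (_ | ⟨x, y, h⟩)
  · exact ⟨0, rfl⟩
  · obtain ⟨x', rfl⟩ : ∃ x', x = C.u ^ 2 * x' + C.r := ⟨(x - C.r) / C.u ^ 2, by field_simp; ring⟩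
    obtain ⟨y', rfl⟩ : ∃ y', y = C.u ^ 3 * y' + C.u ^ 2 * C.s * x' + C.t :=
      ⟨(y - C.u ^ 2 * C.s * x' - C.t) / C.u ^ 3, by field_simp; ring⟩
    exact ⟨.some x' y' ((nonsingular_variableChange_iff C W x' y').mpr h), rfl⟩

end VariableChangePoints

/-! ### Tate normal form for a point of order four -/

section FourTorsion

/-- The universal family of curves with the point `(0, 0)` of order four. -/
@[simps]
def fourTorsionCurve {R : Type*} [CommRing R] (α β : R) : WeierstrassCurve R :=
  ⟨α, β, α * β, 0, 0⟩

theorem fourTorsionCurve_Δ {R : Type*} [CommRing R] (α β : R) :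
    (fourTorsionCurve α β).Δ = α ^ 2 * β ^ 4 * (α ^ 2 - 16 * β) := by
  simp only [Δ, b₂, b₄, b₆, b₈, fourTorsionCurve]
  ring

theorem fourTorsionCurve_c₄ {R : Type*} [CommRing R] (α β : R) :
    (fourTorsionCurve α β).c₄ = α ^ 4 - 16 * α ^ 2 * β + 16 * β ^ 2 := by
  simp only [c₄, b₂, b₄, fourTorsionCurve]
  ring

theorem map_fourTorsionCurve {R S : Type*} [CommRing R] [CommRing S] (f : R →+* S) (α β : R) :
    (fourTorsionCurve α β).map f = fourTorsionCurve (f α) (f β) := by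
  ext <;> simp [fourTorsionCurve]

variable {F : Type*} [Field F]

/-- Since only β/α² matters up to isomorphism, α is free to be chosen so as to clear denominators.
-/
theorem variableChange_fourTorsionCurve (u : Fˣ) (α β : F) :
    (⟨u, 0, 0, 0⟩ : VariableChange F) • fourTorsionCurve (u * α) (u ^ 2 * β) =
      fourTorsionCurve α β := by
  have hu : (u : F) ≠ 0 := u.ne_zero
  ext <;> simp only [variableChange_def, fourTorsionCurve, Units.val_inv_eq_inv_val] <;>
    field_simp <;> ring

variable {α β : F}

theorem nonsingular_fourTorsionCurve_zero (hα : α ≠ 0) (hβ : β ≠ 0) :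
    (fourTorsionCurve α β).toAffine.Nonsingular 0 0 := by
  rw [Affine.nonsingular_zero]
  exact ⟨rfl, Or.inl (mul_ne_zero hα hβ)⟩

theorem nonsingular_fourTorsionCurve_double (hβ : β ≠ 0) :
    (fourTorsionCurve α β).toAffine.Nonsingular (-β) 0 := by
  rw [Affine.nonsingular_iff', Affine.equation_iff]
  simp only [fourTorsionCurve]
  refine ⟨by ring, Or.inl ?_⟩
  have : α * 0 - (3 * (-β) ^ 2 + 2 * β * -β + 0) = -(β ^ 2) := by ring
  rw [this]
  exact neg_ne_zero.mpr (pow_ne_zero 2 hβ)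

variable [DecidableEq F]

/-- The tangent at the origin is y = 0, which meets the cubic again at x = -β; the relation a₁a₂ =
a₃ makes that point its own negative. -/
theorem two_nsmul_fourTorsionCurve (hα : α ≠ 0) (hβ : β ≠ 0) :
    2 • (Affine.Point.some 0 0 (nonsingular_fourTorsionCurve_zero hα hβ)) =
      Affine.Point.some (-β) 0 (nonsingular_fourTorsionCurve_double hβ) := by
  have hne : (0 : F) ≠ (fourTorsionCurve α β).toAffine.negY 0 0 := by
    simp [Affine.negY, hα, hβ]
  rw [two_nsmul, Affine.Point.add_self_of_Y_ne hne, Affine.Point.some.injEq,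
    Affine.slope_of_Y_ne rfl hne]
  simp [Affine.addX, Affine.addY, Affine.negAddY, Affine.negY]

theorem four_nsmul_fourTorsionCurve (hα : α ≠ 0) (hβ : β ≠ 0) :
    4 • (Affine.Point.some 0 0 (nonsingular_fourTorsionCurve_zero hα hβ)) = 0 := by
  rw [show (4 : ℕ) = 2 * 2 from rfl, mul_nsmul, two_nsmul_fourTorsionCurve hα hβ, two_nsmul]
  apply Affine.Point.add_self_of_Y_eq
  simp [Affine.negY]

theorem addOrderOf_fourTorsionCurve (hα : α ≠ 0) (hβ : β ≠ 0) :
    addOrderOf (Affine.Point.some 0 0 (nonsingular_fourTorsionCurve_zero hα hβ)) = 4 := by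
  refine addOrderOf_eq_prime_pow (p := 2) (n := 1) ?_ (four_nsmul_fourTorsionCurve hα hβ)
  rw [pow_one, two_nsmul_fourTorsionCurve hα hβ]
  exact Affine.Point.some_ne_zero _

/-- A curve with a point of order four is isomorphic to a member of the universal family. -/
theorem exists_variableChange_eq_fourTorsionCurve (W : WeierstrassCurve F) {P : W.toAffine.Point}
    (hP : addOrderOf P = 4) :
    ∃ (C : VariableChange F) (b : F), b ≠ 0 ∧ C • W = fourTorsionCurve 1 b := by
  have h4 : 4 • P = 0 := hP ▸ addOrderOf_nsmul_eq_zero P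
  have h2 : 2 • P ≠ 0 := fun h => by
    have := hP ▸ addOrderOf_dvd_of_nsmul_eq_zero h
    omega
  have h1 : P ≠ 0 := fun h => by simp [h] at h2
  obtain _ | ⟨x, y, h⟩ := P
  · exact absurd rfl h1
  have hy : y ≠ W.toAffine.negY x y := fun hy => h2 (by
    rw [two_nsmul]; exact Affine.Point.add_self_of_Y_eq hy)
  obtain ⟨d, hd⟩ : ∃ d, d = W.a₃ + x * W.a₁ + 2 * y := ⟨_, rfl⟩
  have hd0 : d ≠ 0 := by
    intro h0
    apply hy
    rw [Affine.negY]
    linear_combination h0 - hd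
  -- `s` is the slope of the tangent at P. Moving P to the origin kills a₆, and making its tangent
  -- horizontal kills a₄.
  obtain ⟨s, hs⟩ : ∃ s, d * s = W.a₄ + 2 * x * W.a₂ - y * W.a₁ + 3 * x ^ 2 :=
    ⟨(W.a₄ + 2 * x * W.a₂ - y * W.a₁ + 3 * x ^ 2) / d, mul_div_cancel₀ _ hd0⟩
  set C : VariableChange F := ⟨1, x, s, y⟩ with hC
  have e3 : (C • W).a₃ = d := by simp [variableChange_def, hC, hd]
  have e4 : (C • W).a₄ = 0 := by
    simp only [variableChange_def, hC]
    simp only [inv_one, Units.val_one, one_pow, one_mul]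
    linear_combination -hs + s * hd
  have e6 : (C • W).a₆ = 0 := by
    have := h.1
    rw [Affine.equation_iff] at this
    simp only [variableChange_def, hC]
    simp only [inv_one, Units.val_one, one_pow, one_mul]
    linear_combination -this
  have hns : (C • W).toAffine.Nonsingular 0 0 := by
    rw [nonsingular_variableChange_iff]
    simpa [hC] using h
  have hmap : pointVariableChange C W (.some 0 0 hns) = .some x y h := by
    rw [pointVariableChange_some, Affine.Point.some.injEq]
    simp [hC]
  have h4' : 4 • Affine.Point.some 0 0 hns = 0 := by
    apply pointVariableChange_injective C W
    rw [map_nsmul, hmap, h4, map_zero]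
  have hne : (0 : F) ≠ (C • W).toAffine.negY 0 0 := by
    simp [Affine.negY, e3, hd0, eq_comm]
  -- Now 2P = (-a₂, a₁a₂ - a₃), which is its own negative exactly when a₁a₂ = a₃.
  have hdouble : (C • W).a₁ * (C • W).a₂ = (C • W).a₃ := by
    rw [show (4 : ℕ) = 2 * 2 from rfl, mul_nsmul, two_nsmul, two_nsmul,
      Affine.Point.add_self_of_Y_ne hne] at h4'
    by_contra hcon
    have hne' : (C • W).toAffine.addY 0 0 0 ((C • W).toAffine.slope 0 0 0 0) ≠
        (C • W).toAffine.negY ((C • W).toAffine.addX 0 0 ((C • W).toAffine.slope 0 0 0 0))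
          ((C • W).toAffine.addY 0 0 0 ((C • W).toAffine.slope 0 0 0 0)) := by
      rw [Affine.slope_of_Y_ne rfl hne, e4]
      simp only [Affine.addX, Affine.addY, Affine.negAddY, Affine.negY]
      intro h'
      apply hcon
      simp only [mul_zero, add_zero, sub_zero, zero_div, zero_pow two_ne_zero,
        neg_zero, zero_sub, mul_neg] at h'
      linear_combination h'
    rw [Affine.Point.add_self_of_Y_ne hne'] at h4'
    exact Affine.Point.some_ne_zero _ h4'
  have ha1 : (C • W).a₁ ≠ 0 := fun h0 => hd0 (by rw [← e3, ← hdouble, h0, zero_mul])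
  have ha2 : (C • W).a₂ ≠ 0 := fun h0 => hd0 (by rw [← e3, ← hdouble, h0, mul_zero])
  have heq : C • W = fourTorsionCurve (C • W).a₁ (C • W).a₂ := by
    ext
    · rfl
    · rfl
    · exact hdouble.symm
    · exact e4
    · exact e6
  refine ⟨⟨Units.mk0 _ ha1, 0, 0, 0⟩ * C, (C • W).a₂ / (C • W).a₁ ^ 2,
    div_ne_zero ha2 (pow_ne_zero 2 ha1), ?_⟩
  rw [mul_smul, ← variableChange_fourTorsionCurve (Units.mk0 _ ha1)]
  refine congrArg _ (heq.trans ?_)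
  congr 1
  · simp
  · rw [Units.val_mk0, mul_div_cancel₀ _ (pow_ne_zero 2 ha1)]

end FourTorsion

end WeierstrassCurve

namespace WeierstrassCurve

/-! ### Reduced models and comparison with a minimal equation -/

section LocalModels

open IsDedekindDomain.HeightOneSpectrum IsLocalRing

section Valuation

variable {K Γ : Type*} [Field K] [LinearOrderedCommGroupWithZero Γ] (v : Valuation K Γ)

theorem singularAt_variableChange_iff {C : VariableChange K} {W : WeierstrassCurve K}
    (hu : v C.u = 1) (hr : v C.r ≤ 1) (hs : v C.s ≤ 1) (ht : v C.t ≤ 1) (x y : K) :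
    SingularAt v (C • W) x y ↔
      SingularAt v W (C.u ^ 2 * x + C.r) (C.u ^ 3 * y + C.u ^ 2 * C.s * x + C.t) := by
  have hun : ∀ (n : ℕ) (z : K), v (C.u ^ n * z) = v z := fun n z => by simp [hu]
  have hadd : ∀ a b : K, v b ≤ 1 → (v (a + b) ≤ 1 ↔ v a ≤ 1) := fun a b hb =>
    ⟨fun h => by simpa using v.map_sub_le h hb, fun h => v.map_add_le h hb⟩
  have hadd' : ∀ a b : K, v b < 1 → (v (a + b) < 1 ↔ v a < 1) := fun a b hb =>
    ⟨fun h => by simpa using v.map_sub_lt h hb, fun h => v.map_add_lt h hb⟩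
  unfold SingularAt
  rw [hadd _ _ hr, hun, ← partialY_variableChange, hun]
  refine and_congr_right fun hx => ?_
  rw [hadd _ _ ht, hadd _ _ (by
    rw [mul_assoc, hun]; exact val_mul_le v hs hx), hun]
  refine and_congr_right fun _ => ?_
  refine and_congr_left fun hY => ?_
  rw [← hun 4 (_ - _), partialX_variableChange, ← partialY_variableChange, hadd']
  exact val_mul_lt v hs (by rwa [hun])

end Valuation

variable {R : Type*} [CommRing R] [IsDomain R] [IsDiscreteValuationRing R]
variable {K : Type*} [Field K] [Algebra R K] [IsFractionRing R K]

/-- An integral Weierstrass equation which cannot be made smaller by an integral substitution. -/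
def IsReducedModel (W : WeierstrassCurve R) : Prop :=
  ∀ (r s t u : R) (W' : WeierstrassCurve R), u ∈ maximalIdeal R →
    (⟨1, r, s, t⟩ : VariableChange R) • W ≠
      ⟨u * W'.a₁, u ^ 2 * W'.a₂, u ^ 3 * W'.a₃, u ^ 4 * W'.a₄, u ^ 6 * W'.a₆⟩

theorem exists_algebraMap_eq_or_mul_eq_one (x : K) :
    (∃ a : R, algebraMap R K a = x) ∨ ∃ w ∈ maximalIdeal R, algebraMap R K w * x = 1 := by
  rcases ValuationRing.isInteger_or_isInteger R x with ⟨a, ha⟩ | ⟨w, hw⟩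
  · exact Or.inl ⟨a, ha⟩
  · by_cases hm : w ∈ maximalIdeal R
    · by_cases hx : x = 0
      · exact Or.inl ⟨0, by simp [hx]⟩
      · exact Or.inr ⟨w, hm, by rw [hw, inv_mul_cancel₀ hx]⟩
    · obtain ⟨w', hw'⟩ : ∃ w', w * w' = 1 := (notMem_maximalIdeal.mp hm).exists_right_inv
      refine Or.inl ⟨w', ?_⟩
      have := congrArg (algebraMap R K) hw'
      rw [map_mul, map_one, hw] at this
      exact (eq_of_inv_mul_eq_one this).symm

/-- The substitution between two integral models is integral as soon as it does not enlarge the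
discriminant. -/
theorem exists_integral_variableChange {W W' : WeierstrassCurve R} {C : VariableChange K}
    (hC : C • (W⁄K) = W'⁄K) {u : R} (hu : algebraMap R K u = C.u) :
    ∃ r s t : R, algebraMap R K r = C.r ∧ algebraMap R K s = C.s ∧ algebraMap R K t = C.t ∧
      (⟨1, r, s, t⟩ : VariableChange R) • W =
        ⟨u * W'.a₁, u ^ 2 * W'.a₂, u ^ 3 * W'.a₃, u ^ 4 * W'.a₄, u ^ 6 * W'.a₆⟩ := by
  set f := algebraMap R K with hf
  have hinj : Function.Injective f := IsFractionRing.injective R K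
  have hu0 : (C.u : K) ≠ 0 := C.u.ne_zero
  have e1 : f u * f W'.a₁ = f W.a₁ + 2 * C.s := by
    have := congrArg a₁ hC
    simp only [variableChange_a₁, baseChange, map_a₁, ← hf, Units.val_inv_eq_inv_val] at this
    rw [← this, hu, mul_inv_cancel_left₀ hu0]
  have e2 : f u ^ 2 * f W'.a₂ = f W.a₂ - C.s * f W.a₁ + 3 * C.r - C.s ^ 2 := by
    have := congrArg a₂ hC
    simp only [variableChange_a₂, baseChange, map_a₁, map_a₂, ← hf,
      Units.val_inv_eq_inv_val] at this
    rw [← this, hu]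
    field_simp
  have e3 : f u ^ 3 * f W'.a₃ = f W.a₃ + C.r * f W.a₁ + 2 * C.t := by
    have := congrArg a₃ hC
    simp only [variableChange_a₃, baseChange, map_a₁, map_a₃, ← hf,
      Units.val_inv_eq_inv_val] at this
    rw [← this, hu]
    field_simp
  have e4 : f u ^ 4 * f W'.a₄ = f W.a₄ - C.s * f W.a₃ + 2 * C.r * f W.a₂ -
      (C.t + C.r * C.s) * f W.a₁ + 3 * C.r ^ 2 - 2 * C.s * C.t := by
    have := congrArg a₄ hC
    simp only [variableChange_a₄, baseChange, map_a₁, map_a₂, map_a₃, map_a₄, ← hf,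
      Units.val_inv_eq_inv_val] at this
    rw [← this, hu]
    field_simp
  have e6 : f u ^ 6 * f W'.a₆ = f W.a₆ + C.r * f W.a₄ + C.r ^ 2 * f W.a₂ + C.r ^ 3 -
      C.t * f W.a₃ - C.t ^ 2 - C.r * C.t * f W.a₁ := by
    have := congrArg a₆ hC
    simp only [variableChange_a₆, baseChange, map_a₁, map_a₂, map_a₃, map_a₄, map_a₆, ← hf,
      Units.val_inv_eq_inv_val] at this
    rw [← this, hu]
    field_simp
  have e6' : f u ^ 6 * f W'.b₆ = f W.b₆ + 2 * C.r * f W.b₄ + C.r ^ 2 * f W.b₂ + 4 * C.r ^ 3 := by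
    have := congrArg b₆ hC
    simp only [variableChange_b₆, baseChange, map_b₂, map_b₄, map_b₆, ← hf,
      Units.val_inv_eq_inv_val] at this
    rw [← this, hu]
    field_simp
  have e8' : f u ^ 8 * f W'.b₈ = f W.b₈ + 3 * C.r * f W.b₆ + 3 * C.r ^ 2 * f W.b₄ +
      C.r ^ 3 * f W.b₂ + 3 * C.r ^ 4 := by
    have := congrArg b₈ hC
    simp only [variableChange_b₈, baseChange, map_b₂, map_b₄, map_b₆, map_b₈, ← hf,
      Units.val_inv_eq_inv_val] at this
    rw [← this, hu]
    field_simp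
  have hone : (1 : R) ∉ maximalIdeal R := (Ideal.ne_top_iff_one _).mp (maximalIdeal.isMaximal R).ne_top
  -- If r were not integral, w = 1/r would lie in the maximal ideal. The b₈ and b₆ relations have
  -- leading terms 3r⁴ and 4r³, so 3 and 4 would lie there too, hence 1.
  obtain ⟨r, hr⟩ : ∃ r, f r = C.r := by
    refine (exists_algebraMap_eq_or_mul_eq_one C.r).resolve_right ?_
    rintro ⟨w, hw, hwr⟩
    rw [← hf] at hwr
    have h3 : (3 : R) = w * (u ^ 8 * W'.b₈ * w ^ 3 -
        (W.b₈ * w ^ 3 + 3 * W.b₆ * w ^ 2 + 3 * W.b₄ * w + W.b₂)) := by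
      apply hinj
      simp only [map_mul, map_sub, map_add, map_pow, map_ofNat]
      linear_combination (-f w ^ 4) * e8' - (3 * f w ^ 3 * f W.b₆ +
        3 * f w ^ 2 * f W.b₄ * (f w * C.r + 1) +
        f w * f W.b₂ * ((f w * C.r) ^ 2 + f w * C.r + 1) +
        3 * ((f w * C.r) ^ 3 + (f w * C.r) ^ 2 + f w * C.r + 1)) * hwr
    have h4 : (4 : R) = w * (u ^ 6 * W'.b₆ * w ^ 2 -
        (W.b₆ * w ^ 2 + 2 * W.b₄ * w + W.b₂)) := by
      apply hinj
      simp only [map_mul, map_sub, map_add, map_pow, map_ofNat]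
      linear_combination (-f w ^ 3) * e6' - (2 * f w ^ 2 * f W.b₄ +
        f w * f W.b₂ * (f w * C.r + 1) +
        4 * ((f w * C.r) ^ 2 + f w * C.r + 1)) * hwr
    apply hone
    rw [show (1 : R) = 4 - 3 by norm_num]
    exact sub_mem (h4 ▸ Ideal.mul_mem_right _ _ hw) (h3 ▸ Ideal.mul_mem_right _ _ hw)
  -- With r integral, the a₂ relation is a monic quadratic in s up to sign, and so is the a₆
  -- relation in t.
  obtain ⟨s, hs⟩ : ∃ s, f s = C.s := by
    refine (exists_algebraMap_eq_or_mul_eq_one C.s).resolve_right ?_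
    rintro ⟨w, hw, hws⟩
    rw [← hf] at hws
    apply hone
    have h1 : (1 : R) = w * ((W.a₂ + 3 * r - u ^ 2 * W'.a₂) * w - W.a₁) := by
      apply hinj
      simp only [map_mul, map_sub, map_add, map_pow, map_ofNat, map_one, hr]
      linear_combination (f w ^ 2) * e2 - (f w * f W.a₁ + f w * C.s + 1) * hws
    rw [h1]
    exact Ideal.mul_mem_right _ _ hw
  obtain ⟨t, ht⟩ : ∃ t, f t = C.t := by
    refine (exists_algebraMap_eq_or_mul_eq_one C.t).resolve_right ?_
    rintro ⟨w, hw, hwt⟩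
    rw [← hf] at hwt
    apply hone
    have h1 : (1 : R) = w * ((W.a₆ + r * W.a₄ + r ^ 2 * W.a₂ + r ^ 3 - u ^ 6 * W'.a₆) * w -
        (W.a₃ + r * W.a₁)) := by
      apply hinj
      simp only [map_mul, map_sub, map_add, map_pow, map_one, hr]
      linear_combination (f w ^ 2) * e6 -
        (f w * (f W.a₃ + C.r * f W.a₁) + f w * C.t + 1) * hwt
    rw [h1]
    exact Ideal.mul_mem_right _ _ hw
  refine ⟨r, s, t, hr, hs, ht, ?_⟩
  ext <;> apply hinj <;>
    simp only [variableChange_def, inv_one, Units.val_one, one_pow, one_mul, map_mul, map_sub,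
      map_add, map_pow, map_ofNat, hr, hs, ht, e1, e2, e3, e4, e6]

/-- Since Δ(W) = u¹²Δ(E), a `C.u` of valuation above 1 would give the integral equation W a
discriminant of larger absolute value than that of the minimal E. -/
theorem IsMinimal.valuation_le_one (E : WeierstrassCurve K) [E.IsElliptic] {W : WeierstrassCurve R}
    {C : VariableChange K} (hC : C • (W⁄K) = E) [hE : IsMinimal R E] :
    valuation K (IsDiscreteValuationRing.maximalIdeal R) C.u ≤ 1 := by
  set v := valuation K (IsDiscreteValuationRing.maximalIdeal R) with hv
  have hW : C⁻¹ • E = W⁄K := by rw [← hC, inv_smul_smul]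
  have hint : IsIntegral R (C⁻¹ • E) := ⟨W, hW⟩
  have h := hE.val_Δ_maximal.2 hint
  simp only [one_smul] at h
  by_contra! hlt
  have hΔ : (C⁻¹ • E).Δ = C.u ^ 12 * E.Δ := by
    rw [variableChange_Δ]
    simp [VariableChange.inv_def]
  have hne : v E.Δ ≠ 0 := (Valuation.ne_zero_iff _).mpr E.isUnit_Δ.ne_zero
  have hlt' : v E.Δ < v (C⁻¹ • E).Δ := by
    rw [hΔ, map_mul, map_pow]
    exact lt_mul_of_one_lt_left (zero_lt_iff.mpr hne) (one_lt_pow₀ hlt (by norm_num))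
  have h1 : (valuation_Δ_aux R E : WithZero (Multiplicative ℤ)) <
      valuation_Δ_aux R (C⁻¹ • E) := by
    rwa [valuation_Δ_aux_eq_of_isIntegral, valuation_Δ_aux_eq_of_isIntegral]
  exact absurd (h (le_of_lt h1)) (not_le_of_gt h1)

/-- A reduced model computes the valuation of the minimal discriminant and the singular points of
the reduction of a minimal model. -/
theorem IsReducedModel.integral_of_isMinimal {W : WeierstrassCurve R} (hW : IsReducedModel W)
    (E : WeierstrassCurve K) [E.IsElliptic] {C : VariableChange K} (hC : C • (W⁄K) = E)
    [hE : IsMinimal R E] :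
    valuation K (IsDiscreteValuationRing.maximalIdeal R) C.u = 1 ∧
    valuation K (IsDiscreteValuationRing.maximalIdeal R) C.r ≤ 1 ∧
    valuation K (IsDiscreteValuationRing.maximalIdeal R) C.s ≤ 1 ∧
    valuation K (IsDiscreteValuationRing.maximalIdeal R) C.t ≤ 1 := by
  have hu1 := IsMinimal.valuation_le_one E hC
  obtain ⟨u, hu⟩ := IsDiscreteValuationRing.exists_lift_of_le_one hu1
  obtain ⟨r, s, t, hr, hs, ht, h⟩ := exists_integral_variableChange (W' := E.integralModel R)
    (hC.trans (baseChange_integralModel_eq R E).symm) hu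
  rw [← hr, ← hs, ← ht]
  refine ⟨le_antisymm hu1 ?_, valuation_le_one _ _, valuation_le_one _ _, valuation_le_one _ _⟩
  -- A non-unit u would be exactly the shrinking that `IsReducedModel` forbids.
  by_contra! hlt
  rw [← hu] at hlt
  exact hW r s t u _ ((valuation_lt_one_iff_mem (K := K) _ _).mp hlt) h

open scoped Classical in
theorem IsReducedModel.exists_addSubgroup_of_isMinimal {W : WeierstrassCurve R}
    (hW : IsReducedModel W) (E : WeierstrassCurve K) [E.IsElliptic] {C : VariableChange K}
    (hC : C • (W⁄K) = E) [hE : IsMinimal R E] :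
    ∃ H : AddSubgroup (W⁄K).toAffine.Point, H.index = (nonsingularReductionSubgroup R E).index ∧
      ∀ x y h, Affine.Point.some x y h ∈ H ↔
        ¬ SingularAt (valuation K (IsDiscreteValuationRing.maximalIdeal R)) (W⁄K) x y := by
  obtain ⟨hu, hr, hs, ht⟩ := hW.integral_of_isMinimal E hC
  subst hC
  have hbij : Function.Bijective (pointVariableChange C (W⁄K)) :=
    ⟨pointVariableChange_injective _ _, pointVariableChange_surjective _ _⟩
  refine ⟨(nonsingularReductionSubgroup R (C • (W⁄K))).map (pointVariableChange C (W⁄K)),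
    AddSubgroup.index_map_of_bijective hbij _, fun x y h => ?_⟩
  obtain ⟨Q, hQ⟩ := hbij.2 (.some x y h)
  rw [← hQ, AddSubgroup.mem_map_iff_mem hbij.1]
  obtain _ | ⟨x', y', h'⟩ := Q
  · exact absurd hQ.symm (Affine.Point.some_ne_zero _)
  · rw [pointVariableChange_some, Affine.Point.some.injEq] at hQ
    rw [← hQ.1, ← hQ.2, ← singularAt_variableChange_iff _ hu hr hs ht]
    exact hasNonsingularReduction_some_iff R (C • (W⁄K)) h'

open scoped Classical in
/-- The local Tamagawa number may be computed on any reduced model. -/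
theorem IsReducedModel.exists_addSubgroup {W : WeierstrassCurve R} (hW : IsReducedModel W)
    (E : WeierstrassCurve K) [E.IsElliptic] {C : VariableChange K} (hC : C • (W⁄K) = E) :
    ∃ H : AddSubgroup (W⁄K).toAffine.Point, H.index = E.localTamagawaNumber R ∧
      ∀ x y h, Affine.Point.some x y h ∈ H ↔
        ¬ SingularAt (valuation K (IsDiscreteValuationRing.maximalIdeal R)) (W⁄K) x y := by
  have : (E.minimal R).IsElliptic := by unfold minimal; infer_instance
  refine hW.exists_addSubgroup_of_isMinimal (E.minimal R)
    (C := (E.exists_isMinimal R).choose * C) ?_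
  rw [mul_smul, hC]
  rfl

end LocalModels

end WeierstrassCurve

namespace WeierstrassCurve

/-! ### Local Tamagawa numbers on reduced models -/

section LocalTamagawa

open IsDedekindDomain.HeightOneSpectrum IsLocalRing

theorem c₄_mk_mul {R : Type*} [CommRing R] (u : R) (W : WeierstrassCurve R) :
    (⟨u * W.a₁, u ^ 2 * W.a₂, u ^ 3 * W.a₃, u ^ 4 * W.a₄, u ^ 6 * W.a₆⟩ :
      WeierstrassCurve R).c₄ = u ^ 4 * W.c₄ := by
  simp only [c₄, b₂, b₄]
  ring

theorem Δ_mk_mul {R : Type*} [CommRing R] (u : R) (W : WeierstrassCurve R) :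
    (⟨u * W.a₁, u ^ 2 * W.a₂, u ^ 3 * W.a₃, u ^ 4 * W.a₄, u ^ 6 * W.a₆⟩ :
      WeierstrassCurve R).Δ = u ^ 12 * W.Δ := by
  simp only [Δ, b₂, b₄, b₆, b₈]
  ring

theorem baseChange_fourTorsionCurve {R K : Type*} [CommRing R] [Field K] [Algebra R K] (α β : R) :
    (fourTorsionCurve α β)⁄K = fourTorsionCurve (algebraMap R K α) (algebraMap R K β) :=
  map_fourTorsionCurve _ α β

theorem exists_nsmul_of_eq_fourTorsionCurve {F : Type*} [Field F] [DecidableEq F]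
    {V : WeierstrassCurve F} {α β : F} (hV : V = fourTorsionCurve α β) (hα : α ≠ 0) (hβ : β ≠ 0) :
    ∃ (h0 : V.toAffine.Nonsingular 0 0) (h1 : V.toAffine.Nonsingular (-β) 0),
      2 • Affine.Point.some 0 0 h0 = .some (-β) 0 h1 ∧ 4 • Affine.Point.some 0 0 h0 = 0 := by
  subst hV
  exact ⟨_, _, two_nsmul_fourTorsionCurve hα hβ, four_nsmul_fourTorsionCurve hα hβ⟩

/-- Vieta's relations for the three intersection points of a line with the curve. -/
theorem vieta_addX {F : Type*} [Field F] [DecidableEq F] {W : WeierstrassCurve F} {x₁ x₂ y₁ y₂ : F}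
    (h₁ : W.toAffine.Equation x₁ y₁) (h₂ : W.toAffine.Equation x₂ y₂)
    (h : ¬(x₁ = x₂ ∧ y₁ = W.toAffine.negY x₂ y₂)) {l x₃ : F}
    (hl : l = W.toAffine.slope x₁ x₂ y₁ y₂) (h₃ : x₃ = W.toAffine.addX x₁ x₂ l) :
    x₁ + x₂ + x₃ = l ^ 2 + W.a₁ * l - W.a₂ ∧
    x₁ * x₂ + x₁ * x₃ + x₂ * x₃ =
      2 * x₁ * l ^ 2 + (W.a₁ * x₁ - 2 * y₁ - W.a₃) * l + (-W.a₁ * y₁ + W.a₄) ∧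
    x₁ * x₂ * x₃ =
      x₁ ^ 2 * l ^ 2 - (2 * x₁ * y₁ + W.a₃ * x₁) * l + (y₁ ^ 2 + W.a₃ * y₁ - W.a₆) := by
  have key := Affine.addPolynomial_slope h₁ h₂ h
  rw [← hl, ← h₃, Affine.addPolynomial_eq, neg_inj, Cubic.prod_X_sub_C_eq,
    Cubic.toPoly_injective] at key
  simp only [Cubic.mk.injEq, true_and] at key
  obtain ⟨k₁, k₂, k₃⟩ := key
  exact ⟨by linear_combination k₁, by linear_combination -k₂, by linear_combination k₃⟩

variable {R : Type*} [CommRing R] [IsDomain R] [IsDiscreteValuationRing R]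

/-- A substitution with unit scaling factor 1 fixes c₄, whereas a shrinkable equation has c₄
divisible by u⁴. -/
theorem isReducedModel_of_c₄ {W : WeierstrassCurve R} (h : W.c₄ ∉ maximalIdeal R ^ 4) :
    IsReducedModel W := by
  intro r s t u W' hu heq
  have := congrArg c₄ heq
  rw [variableChange_c₄, c₄_mk_mul, inv_one, Units.val_one, one_pow, one_mul] at this
  exact h (this ▸ Ideal.mul_mem_right _ _ (Ideal.pow_mem_pow hu 4))

theorem isReducedModel_of_Δ {W : WeierstrassCurve R} (h : W.Δ ∉ maximalIdeal R ^ 12) :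
    IsReducedModel W := by
  intro r s t u W' hu heq
  have := congrArg Δ heq
  rw [variableChange_Δ, Δ_mk_mul, inv_one, Units.val_one, one_pow, one_mul] at this
  exact h (this ▸ Ideal.mul_mem_right _ _ (Ideal.pow_mem_pow hu 12))

/-- An integral singular point of the reduction forces the discriminant into the square of the
maximal ideal. -/
theorem Δ_mem_sq_of_singular {W : WeierstrassCurve R} {x y : R} (h : W.toAffine.Equation x y)
    (hX : W.a₁ * y - (3 * x ^ 2 + 2 * W.a₂ * x + W.a₄) ∈ maximalIdeal R)
    (hY : 2 * y + W.a₁ * x + W.a₃ ∈ maximalIdeal R) : W.Δ ∈ maximalIdeal R ^ 2 := by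
  have h1 : W.Δ = ((⟨1, x, 0, y⟩ : VariableChange R) • W).Δ := by
    rw [variableChange_Δ, inv_one, Units.val_one, one_pow, one_mul]
  have e6 : ((⟨1, x, 0, y⟩ : VariableChange R) • W).a₆ = 0 := by
    rw [Affine.equation_iff] at h
    simp only [variableChange_def, inv_one, Units.val_one, one_pow, one_mul]
    linear_combination -h
  have e3 : ((⟨1, x, 0, y⟩ : VariableChange R) • W).a₃ ∈ maximalIdeal R := by
    simp only [variableChange_def, inv_one, Units.val_one, one_pow, one_mul]
    convert hY using 1
    ring
  have e4 : ((⟨1, x, 0, y⟩ : VariableChange R) • W).a₄ ∈ maximalIdeal R := by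
    simp only [variableChange_def, inv_one, Units.val_one, one_pow, one_mul]
    convert neg_mem hX using 1
    ring
  rw [h1]
  generalize (⟨1, x, 0, y⟩ : VariableChange R) • W = V at *
  have e33 : V.a₃ ^ 2 ∈ maximalIdeal R ^ 2 := Ideal.pow_mem_pow e3 2
  have e44 : V.a₄ ^ 2 ∈ maximalIdeal R ^ 2 := Ideal.pow_mem_pow e4 2
  have e34 : V.a₃ * V.a₄ ∈ maximalIdeal R ^ 2 := by
    rw [pow_two]; exact Ideal.mul_mem_mul e3 e4
  -- With the singular point at the origin, a₆ = 0 and every term of Δ has degree at least two in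
  -- a₃, a₄.
  have : V.Δ = V.a₃ ^ 2 * (-V.b₂ ^ 2 * V.a₂ - 8 * V.a₁ ^ 2 * (2 * V.a₄ + V.a₁ * V.a₃) - 27 * V.a₃ ^ 2
      + 9 * V.b₂ * (2 * V.a₄ + V.a₁ * V.a₃))
      + V.a₄ ^ 2 * (V.b₂ ^ 2 - 32 * (2 * V.a₄ + V.a₁ * V.a₃))
      + V.a₃ * V.a₄ * (V.b₂ ^ 2 * V.a₁ - 32 * V.a₁ * (2 * V.a₄ + V.a₁ * V.a₃)) := by
    simp only [Δ, b₈, b₄, b₆, e6]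
    ring
  rw [this]
  exact add_mem (add_mem (Ideal.mul_mem_right _ _ e33) (Ideal.mul_mem_right _ _ e44))
    (Ideal.mul_mem_right _ _ e34)

variable {K : Type*} [Field K] [Algebra R K] [IsFractionRing R K]

theorem singularAt_baseChange_iff {W : WeierstrassCurve R} {x y : K} :
    SingularAt (valuation K (IsDiscreteValuationRing.maximalIdeal R)) (W⁄K) x y ↔
      ∃ x₀ y₀ : R, algebraMap R K x₀ = x ∧ algebraMap R K y₀ = y ∧
        W.a₁ * y₀ - (3 * x₀ ^ 2 + 2 * W.a₂ * x₀ + W.a₄) ∈ maximalIdeal R ∧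
        2 * y₀ + W.a₁ * x₀ + W.a₃ ∈ maximalIdeal R := by
  have key : ∀ x₀ y₀ : R, (W⁄K).a₁ * algebraMap R K y₀ - (3 * algebraMap R K x₀ ^ 2 +
      2 * (W⁄K).a₂ * algebraMap R K x₀ + (W⁄K).a₄) =
      algebraMap R K (W.a₁ * y₀ - (3 * x₀ ^ 2 + 2 * W.a₂ * x₀ + W.a₄)) ∧
      2 * algebraMap R K y₀ + (W⁄K).a₁ * algebraMap R K x₀ + (W⁄K).a₃ =
      algebraMap R K (2 * y₀ + W.a₁ * x₀ + W.a₃) := by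
    intro x₀ y₀
    simp [baseChange, map_ofNat]
  have hlt : ∀ r : R, valuation K (IsDiscreteValuationRing.maximalIdeal R) (algebraMap R K r) < 1 ↔
      r ∈ maximalIdeal R := fun r => valuation_lt_one_iff_mem (K := K) _ r
  constructor
  · rintro ⟨hx, hy, hX, hY⟩
    obtain ⟨x₀, rfl⟩ := IsDiscreteValuationRing.exists_lift_of_le_one hx
    obtain ⟨y₀, rfl⟩ := IsDiscreteValuationRing.exists_lift_of_le_one hy
    rw [(key x₀ y₀).1, hlt] at hX
    rw [(key x₀ y₀).2, hlt] at hY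
    exact ⟨x₀, y₀, rfl, rfl, hX, hY⟩
  · rintro ⟨x₀, y₀, rfl, rfl, hX, hY⟩
    refine ⟨valuation_le_one _ _, valuation_le_one _ _, ?_, ?_⟩
    · rwa [(key x₀ y₀).1, hlt]
    · rwa [(key x₀ y₀).2, hlt]

open scoped Classical in
-- Even if the reduced curve is singular, no K-point reduces to its singular point, so E₀ is the
-- whole group.
theorem localTamagawaNumber_eq_one {W : WeierstrassCurve R} (hΔ : W.Δ ∉ maximalIdeal R ^ 2)
    {E : WeierstrassCurve K} [E.IsElliptic] {C : VariableChange K} (hC : C • (W⁄K) = E) :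
    E.localTamagawaNumber R = 1 := by
  have hred : IsReducedModel W :=
    isReducedModel_of_Δ fun h => hΔ (Ideal.pow_le_pow_right (by norm_num) h)
  obtain ⟨H, hH, hmem⟩ := hred.exists_addSubgroup E hC
  rw [← hH, AddSubgroup.index_eq_one, eq_top_iff]
  rintro (_ | ⟨x, y, h⟩) -
  · exact H.zero_mem
  · rw [hmem, singularAt_baseChange_iff]
    rintro ⟨x₀, y₀, rfl, rfl, hX, hY⟩
    refine hΔ (Δ_mem_sq_of_singular ?_ hX hY)
    exact (Affine.map_equation W (IsFractionRing.injective R K) x₀ y₀).mp h.1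

theorem localTamagawaNumber_eq_one_of_hasGoodReduction {E : WeierstrassCurve K} [E.IsElliptic]
    (h : (E.minimal R).HasGoodReduction R) : E.localTamagawaNumber R = 1 := by
  have hv := h.goodReduction
  rw [← integralModel_Δ_eq R] at hv
  refine localTamagawaNumber_eq_one (W := (E.minimal R).integralModel R)
    (C := (E.exists_isMinimal R).choose⁻¹) (fun hm => ?_) ?_
  · have := (valuation_lt_one_iff_mem (K := K) (IsDiscreteValuationRing.maximalIdeal R) _).mpr
      (Ideal.pow_le_self two_ne_zero hm)
    exact this.ne hv
  · rw [baseChange_integralModel_eq]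
    exact inv_smul_smul _ _

theorem hasGoodReduction_minimal {W : WeierstrassCurve R} (hΔ : W.Δ ∉ maximalIdeal R)
    {E : WeierstrassCurve K} [E.IsElliptic] {C : VariableChange K} (hC : C • (W⁄K) = E) :
    (E.minimal R).HasGoodReduction R := by
  have hred : IsReducedModel W :=
    isReducedModel_of_Δ fun h => hΔ (Ideal.pow_le_self (by norm_num) h)
  have : (E.minimal R).IsElliptic := by unfold minimal; infer_instance
  have hC' : ((E.exists_isMinimal R).choose * C) • (W⁄K) = E.minimal R := by
    rw [mul_smul, hC]
    rfl
  have hu := (hred.integral_of_isMinimal (E.minimal R) hC').1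
  refine ⟨?_⟩
  rw [← hC', variableChange_Δ, Units.val_inv_eq_inv_val, map_mul, map_pow, map_inv₀, hu, inv_one,
    one_pow, one_mul, baseChange, map_Δ]
  exact le_antisymm (valuation_le_one _ _)
    (not_lt.mp fun h => hΔ ((valuation_lt_one_iff_mem (K := K) _ _).mp h))

open scoped Classical in
-- The origin reduces to a singular point, so its class modulo E₀ is nontrivial of order dividing 4.
-- Orders divide `Nat.card` of the quotient, which is 0 for an infinite quotient, so finiteness of
-- the index is not needed.
theorem two_dvd_localTamagawaNumber {W : WeierstrassCurve R} (hW : IsReducedModel W)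
    (h3 : W.a₃ ∈ maximalIdeal R) (h4 : W.a₄ ∈ maximalIdeal R)
    {h0 : (W⁄K).toAffine.Nonsingular 0 0} (hP : 4 • Affine.Point.some 0 0 h0 = 0)
    {E : WeierstrassCurve K} [E.IsElliptic] {C : VariableChange K} (hC : C • (W⁄K) = E) :
    2 ∣ E.localTamagawaNumber R := by
  obtain ⟨H, hH, hmem⟩ := hW.exists_addSubgroup E hC
  rw [← hH]
  have hnot : Affine.Point.some 0 0 h0 ∉ H := by
    rw [hmem, not_not, singularAt_baseChange_iff]
    exact ⟨0, 0, map_zero _, map_zero _, by simpa using h4, by simpa using h3⟩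
  have hdvd : addOrderOf (QuotientAddGroup.mk' H (.some 0 0 h0)) ∣ 2 ^ 2 :=
    addOrderOf_dvd_of_nsmul_eq_zero (by rw [← map_nsmul]; norm_num [hP])
  have hne : addOrderOf (QuotientAddGroup.mk' H (.some 0 0 h0)) ≠ 1 := by
    rw [ne_eq, AddMonoid.addOrderOf_eq_one_iff]
    exact fun h => hnot ((QuotientAddGroup.eq_zero_iff _).mp h)
  obtain ⟨k, hk, hk'⟩ := (Nat.dvd_prime_pow Nat.prime_two).mp hdvd
  have : 2 ∣ addOrderOf (QuotientAddGroup.mk' H (.some 0 0 h0)) := by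
    rw [hk']
    exact dvd_pow_self 2 (fun h => hne (by rw [hk', h, pow_zero]))
  exact this.trans (addOrderOf_dvd_natCard _)

theorem two_dvd_localTamagawaNumber_fourTorsionCurve {α β : R} (hα : α ≠ 0) (hβ : β ≠ 0)
    (hW : IsReducedModel (fourTorsionCurve α β)) (hm : α ∈ maximalIdeal R)
    {E : WeierstrassCurve K} [E.IsElliptic] {C : VariableChange K}
    (hC : C • ((fourTorsionCurve α β)⁄K) = E) : 2 ∣ E.localTamagawaNumber R := by
  classical
  have hinj := FaithfulSMul.algebraMap_injective R K
  have hα' : algebraMap R K α ≠ 0 := (map_ne_zero_iff _ hinj).mpr hα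
  have hβ' : algebraMap R K β ≠ 0 := (map_ne_zero_iff _ hinj).mpr hβ
  obtain ⟨h0, -, -, h4⟩ :=
    exists_nsmul_of_eq_fourTorsionCurve (baseChange_fourTorsionCurve α β) hα' hβ'
  refine two_dvd_localTamagawaNumber hW (Ideal.mul_mem_right _ _ hm) (zero_mem _) (h0 := h0) ?_ hC
  convert h4

open scoped Classical in
-- For β in the maximal ideal, 2P = (-β, 0) reduces to the singular origin, so the class of P has
-- order exactly 4.
theorem four_dvd_localTamagawaNumber_fourTorsionCurve {α β : R} (hα : α ≠ 0) (hβ : β ≠ 0)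
    (hW : IsReducedModel (fourTorsionCurve α β)) (hm : β ∈ maximalIdeal R)
    {E : WeierstrassCurve K} [E.IsElliptic] {C : VariableChange K}
    (hC : C • ((fourTorsionCurve α β)⁄K) = E) : 4 ∣ E.localTamagawaNumber R := by
  have hinj := FaithfulSMul.algebraMap_injective R K
  have hα' : algebraMap R K α ≠ 0 := (map_ne_zero_iff _ hinj).mpr hα
  have hβ' : algebraMap R K β ≠ 0 := (map_ne_zero_iff _ hinj).mpr hβ
  obtain ⟨H, hH, hmem⟩ := hW.exists_addSubgroup E hC
  rw [← hH]
  obtain ⟨h0, h1, h2, h4⟩ :=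
    exists_nsmul_of_eq_fourTorsionCurve (baseChange_fourTorsionCurve α β) hα' hβ'
  have hnot : Affine.Point.some _ _ h1 ∉ H := by
    rw [hmem, not_not, singularAt_baseChange_iff]
    refine ⟨-β, 0, map_neg _ _, map_zero _, ?_, ?_⟩
    · simp only [fourTorsionCurve]
      convert Ideal.mul_mem_left _ (-β) hm using 1
      ring
    · simp only [fourTorsionCurve]
      convert zero_mem (maximalIdeal R) using 1
      ring
  have hord : addOrderOf (QuotientAddGroup.mk' H (.some 0 0 h0)) = 4 := by
    refine addOrderOf_eq_prime_pow (p := 2) (n := 1) ?_ ?_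
    · rw [pow_one, ← map_nsmul, h2]
      exact fun h => hnot ((QuotientAddGroup.eq_zero_iff _).mp h)
    · rw [← map_nsmul]
      norm_num [h4]
  exact hord ▸ addOrderOf_dvd_natCard (QuotientAddGroup.mk' H (.some 0 0 h0))

/-- No line meets `y² + pxy + py = x³ + x²` in three points congruent to `(0, 0)` modulo `p`. -/
theorem no_three_collinear {p : R} (hp : maximalIdeal R = Ideal.span {p}) (hp0 : p ≠ 0)
    {a b a' c : R} {l : K}
    (v₁ : algebraMap R K p * algebraMap R K a + algebraMap R K p * algebraMap R K a' +
      algebraMap R K p * algebraMap R K c = l ^ 2 + algebraMap R K p * l - 1)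
    (v₂ : algebraMap R K p * algebraMap R K a * (algebraMap R K p * algebraMap R K a') +
      algebraMap R K p * algebraMap R K a * (algebraMap R K p * algebraMap R K c) +
      algebraMap R K p * algebraMap R K a' * (algebraMap R K p * algebraMap R K c) =
      2 * (algebraMap R K p * algebraMap R K a) * l ^ 2 +
      (algebraMap R K p * (algebraMap R K p * algebraMap R K a) -
        2 * (algebraMap R K p * algebraMap R K b) - algebraMap R K p) * l +
      -(algebraMap R K p * (algebraMap R K p * algebraMap R K b)))
    (v₃ : algebraMap R K p * algebraMap R K a * (algebraMap R K p * algebraMap R K a') *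
        (algebraMap R K p * algebraMap R K c) =
      (algebraMap R K p * algebraMap R K a) ^ 2 * l ^ 2 -
      (2 * (algebraMap R K p * algebraMap R K a) * (algebraMap R K p * algebraMap R K b) +
        algebraMap R K p * (algebraMap R K p * algebraMap R K a)) * l +
      ((algebraMap R K p * algebraMap R K b) ^ 2 +
        algebraMap R K p * (algebraMap R K p * algebraMap R K b))) : False := by
  have hone : (1 : R) ∉ maximalIdeal R :=
    (Ideal.ne_top_iff_one _).mp (maximalIdeal.isMaximal R).ne_top
  have hinj : Function.Injective (algebraMap R K) := IsFractionRing.injective R K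
  rcases exists_algebraMap_eq_or_mul_eq_one (R := R) l with ⟨l, rfl⟩ | ⟨w, hw, hwl⟩
  · have r₁ : p * (a + a' + c) = l ^ 2 + p * l - 1 := by
      apply hinj
      simp only [map_mul, map_add, map_sub, map_pow, map_one]
      linear_combination v₁
    -- The line is y = lx + pν. Modulo p, Vieta's relations become l² = 1, l(2ν + 1) = 0 and ν² + ν
    -- = 0. The last gives (2ν + 1)² = 1, contradicting the first two.
    obtain ⟨ν, hν⟩ : ∃ ν, ν = b - l * a := ⟨_, rfl⟩
    have r₂ : p * (a * a' + a * c + a' * c) = -(2 * l * ν + p * ν + l) := by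
      apply mul_left_cancel₀ hp0
      apply hinj
      rw [hν]
      simp only [map_mul, map_add, map_sub, map_neg, map_ofNat]
      linear_combination v₂
    have r₃ : p * (a * a' * c) = ν ^ 2 + ν := by
      apply mul_left_cancel₀ (pow_ne_zero 2 hp0)
      apply hinj
      rw [hν]
      simp only [map_mul, map_add, map_sub, map_pow]
      linear_combination v₃
    apply hone
    rw [hp, Ideal.mem_span_singleton]
    refine ⟨p * (a * a' + a * c + a' * c + ν) ^ 2 - (a + a' + c - l) -
      4 * (a * a' * c) * l ^ 2, ?_⟩
    have hl : l * (2 * ν + 1) = -(p * (a * a' + a * c + a' * c + ν)) := by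
      linear_combination r₂
    linear_combination r₁ + 4 * l ^ 2 * r₃ + (l * (2 * ν + 1) -
      p * (a * a' + a * c + a' * c + ν)) * hl
  -- For l not integral, dividing the first relation by l² puts 1 in the maximal ideal.
  · apply hone
    have : (1 : R) = w * (w * (p * (a + a' + c)) - p + w) := by
      apply hinj
      simp only [map_mul, map_add, map_sub, map_one]
      linear_combination (-(algebraMap R K w) ^ 2) * v₁ -
        (algebraMap R K w * l + 1 + algebraMap R K w * algebraMap R K p) * hwl
    rw [this]
    exact Ideal.mul_mem_right _ _ hw

open scoped Classical in
/-- If every point of `y² + pxy + py = x³ + x²` with singular reduction is congruent to `(0, 0)`,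
then there are at most two components, as three points with singular reduction are not collinear. -/
theorem not_four_dvd_localTamagawaNumber {p : R} (hp : maximalIdeal R = Ideal.span {p})
    (hp0 : p ≠ 0) (hW : IsReducedModel (fourTorsionCurve p 1))
    (hsing : ∀ x y : R, (fourTorsionCurve p 1).toAffine.Equation x y →
      p ∣ p * y - (3 * x ^ 2 + 2 * x) → p ∣ 2 * y + p * x + p → p ∣ x ∧ p ∣ y)
    {E : WeierstrassCurve K} [E.IsElliptic] {C : VariableChange K}
    (hC : C • ((fourTorsionCurve p 1)⁄K) = E) : ¬ 4 ∣ E.localTamagawaNumber R := by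
  obtain ⟨H, hH, hmem⟩ := hW.exists_addSubgroup E hC
  rw [← hH]
  have hm : ∀ z : R, z ∈ maximalIdeal R ↔ p ∣ z := fun z => by
    rw [hp, Ideal.mem_span_singleton]
  have hsmall : ∀ x y h, Affine.Point.some x y h ∉ H →
      ∃ x₀ y₀ : R, x = algebraMap R K (p * x₀) ∧ y = algebraMap R K (p * y₀) := by
    intro x y h hn
    rw [hmem, not_not, singularAt_baseChange_iff] at hn
    obtain ⟨x₀, y₀, rfl, rfl, hX, hY⟩ := hn
    have hE := (Affine.map_equation (fourTorsionCurve p 1)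
      (IsFractionRing.injective R K) x₀ y₀).mp h.1
    obtain ⟨⟨a, rfl⟩, ⟨b, rfl⟩⟩ := hsing x₀ y₀ hE
      (by rw [hm] at hX; simpa [fourTorsionCurve] using hX)
      (by rw [hm] at hY; simpa [fourTorsionCurve] using hY)
    exact ⟨a, b, rfl, rfl⟩
  -- P, Q and -(P + Q) are collinear, and P + Q has the same x-coordinate as its negative. Were all
  -- three outside H, `no_three_collinear` would apply.
  have hadd : ∀ P Q, P ∉ H → Q ∉ H → P + Q ∈ H := by
    rintro (_ | ⟨x₁, y₁, h₁⟩) (_ | ⟨x₂, y₂, h₂⟩) hP hQ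
    · exact absurd H.zero_mem hP
    · exact absurd H.zero_mem hP
    · exact absurd H.zero_mem hQ
    by_cases hxy : x₁ = x₂ ∧ y₁ = ((fourTorsionCurve p 1)⁄K).toAffine.negY x₂ y₂
    · rw [Affine.Point.add_of_Y_eq hxy.1 hxy.2]
      exact H.zero_mem
    by_contra hT
    rw [Affine.Point.add_some hxy] at hT
    obtain ⟨c, -, hc, -⟩ := hsmall _ _ _ hT
    obtain ⟨a, b, hx₁, hy₁⟩ := hsmall _ _ _ hP
    obtain ⟨a', -, hx₂, -⟩ := hsmall _ _ _ hQ
    obtain ⟨v₁, v₂, v₃⟩ := vieta_addX h₁.1 h₂.1 hxy rfl hc.symm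
    exact no_three_collinear hp hp0 (by
      simpa [baseChange, fourTorsionCurve, hx₁, hx₂] using v₁) (by
      simpa [baseChange, fourTorsionCurve, hx₁, hx₂, hy₁] using v₂) (by
      simpa [baseChange, fourTorsionCurve, hx₁, hx₂, hy₁] using v₃)
  by_cases htop : H = ⊤
  · rw [htop, AddSubgroup.index_top]
    norm_num
  · obtain ⟨a, ha⟩ : ∃ a, a ∉ H := by
      by_contra! h
      exact htop (eq_top_iff.mpr fun x _ => h x)
    have : H.index = 2 := by
      rw [AddSubgroup.index_eq_two_iff]
      refine ⟨a, fun b => ?_⟩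
      by_cases hb : b ∈ H
      · exact Or.inr ⟨hb, fun h => ha ((AddSubgroup.add_mem_cancel_left H hb).mp h)⟩
      · exact Or.inl ⟨hadd b a hb ha, hb⟩
    rw [this]
    norm_num

end LocalTamagawa

end WeierstrassCurve

namespace WeierstrassCurve

/-! ### Reducedness of the family over the p-adic integers -/

section PadicModels

open IsLocalRing

theorem intCast_mem_maximalIdeal_pow_iff (p : ℕ) [Fact p.Prime] (z : ℤ) (n : ℕ) :
    (z : ℤ_[p]) ∈ maximalIdeal ℤ_[p] ^ n ↔ (p : ℤ) ^ n ∣ z := by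
  rw [PadicInt.maximalIdeal_eq_span_p, Ideal.span_singleton_pow,
    ← PadicInt.norm_le_pow_iff_mem_span_pow, PadicInt.norm_int_le_pow_iff_dvd]

theorem intCast_mem_maximalIdeal_iff (p : ℕ) [Fact p.Prime] (z : ℤ) :
    (z : ℤ_[p]) ∈ maximalIdeal ℤ_[p] ↔ (p : ℤ) ∣ z := by
  simpa using intCast_mem_maximalIdeal_pow_iff p z 1

/-- An integral Weierstrass equation as an equation over the `p`-adic integers. -/
noncomputable def toPadicInt (p : ℕ) [Fact p.Prime] (W : WeierstrassCurve ℤ) :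
    WeierstrassCurve ℤ_[p] :=
  W.map (Int.castRingHom ℤ_[p])

variable (p : ℕ) [Fact p.Prime]

theorem toPadicInt_fourTorsionCurve (α β : ℤ) :
    (fourTorsionCurve α β).toPadicInt p = fourTorsionCurve (α : ℤ_[p]) (β : ℤ_[p]) :=
  map_fourTorsionCurve _ α β

theorem toPadicInt_Δ (W : WeierstrassCurve ℤ) : (W.toPadicInt p).Δ = (W.Δ : ℤ_[p]) :=
  map_Δ _ _

theorem toPadicInt_c₄ (W : WeierstrassCurve ℤ) : (W.toPadicInt p).c₄ = (W.c₄ : ℤ_[p]) :=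
  map_c₄ _ _

theorem isReducedModel_toPadicInt_of_c₄ {W : WeierstrassCurve ℤ} (h : ¬ (p : ℤ) ^ 4 ∣ W.c₄) :
    IsReducedModel (W.toPadicInt p) := by
  apply isReducedModel_of_c₄
  rwa [toPadicInt_c₄, intCast_mem_maximalIdeal_pow_iff]

theorem isReducedModel_toPadicInt_of_Δ {W : WeierstrassCurve ℤ} (h : ¬ (p : ℤ) ^ 12 ∣ W.Δ) :
    IsReducedModel (W.toPadicInt p) := by
  apply isReducedModel_of_Δ
  rwa [toPadicInt_Δ, intCast_mem_maximalIdeal_pow_iff]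

theorem two_dvd_of_toZMod_eq_zero {x : ℤ_[2]} (h : PadicInt.toZMod x = 0) : ∃ y, x = 2 * y := by
  rw [← RingHom.mem_ker, PadicInt.ker_toZMod, PadicInt.maximalIdeal_eq_span_p,
    Ideal.mem_span_singleton] at h
  exact_mod_cast h

theorem two_dvd_of_mem_maximalIdeal {x : ℤ_[2]} (h : x ∈ maximalIdeal ℤ_[2]) : ∃ y, x = 2 * y := by
  rw [PadicInt.maximalIdeal_eq_span_p, Ideal.mem_span_singleton] at h
  exact_mod_cast h

theorem eq_one_of_ne_zero_zmod_two : ∀ {z : ZMod 2}, z ≠ 0 → z = 1 := by decide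

theorem two_ne_zero_padicInt : (2 : ℤ_[2]) ≠ 0 := two_ne_zero

/-- At the prime two, the curves of the family with `β` a uniformizer and `α` even are reduced. -/
theorem isReducedModel_fourTorsionCurve_two {a b : ℤ_[2]} (hb : PadicInt.toZMod b = 1) :
    IsReducedModel (fourTorsionCurve (2 * a) (2 * b)) := by
  intro r s t u W' hu heq
  obtain ⟨w, rfl⟩ := two_dvd_of_mem_maximalIdeal hu
  have E2 := congrArg a₂ heq
  have E4 := congrArg a₄ heq
  have E6 := congrArg a₆ heq
  simp only [variableChange_def, fourTorsionCurve, inv_one, Units.val_one, one_pow,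
    one_mul] at E2 E4 E6
  -- Parity descent: a₄, a₆, a₂ in turn make r, t, s even. After dividing out powers of 2, a₂ makes
  -- ρ odd and a₆ makes τ even; then the a₄ relation equates an odd and an even number.
  obtain ⟨ρ, rfl⟩ : ∃ y, r = 2 * y := by
    apply two_dvd_of_toZMod_eq_zero
    have h := congrArg PadicInt.toZMod E4
    simp only [map_add, map_sub, map_mul, map_pow, map_ofNat, map_zero] at h
    have key : ∀ a b r s t w A : ZMod 2, 0 - s * (2 * a * (2 * b)) + 2 * r * (2 * b) -
      (t + r * s) * (2 * a) + 3 * r ^ 2 - 2 * s * t = (2 * w) ^ 4 * A → r = 0 := by decide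
    exact key _ _ _ _ _ _ _ h
  obtain ⟨τ, rfl⟩ : ∃ y, t = 2 * y := by
    apply two_dvd_of_toZMod_eq_zero
    have h := congrArg PadicInt.toZMod E6
    simp only [map_add, map_sub, map_mul, map_pow, map_ofNat, map_zero] at h
    have key : ∀ a b r t w A : ZMod 2, 0 + 2 * r * 0 + (2 * r) ^ 2 * (2 * b) + (2 * r) ^ 3 -
      t * (2 * a * (2 * b)) - t ^ 2 - 2 * r * t * (2 * a) = (2 * w) ^ 6 * A → t = 0 := by decide
    exact key _ _ _ _ _ _ h
  obtain ⟨σ, rfl⟩ : ∃ y, s = 2 * y := by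
    apply two_dvd_of_toZMod_eq_zero
    have h := congrArg PadicInt.toZMod E2
    simp only [map_add, map_sub, map_mul, map_pow, map_ofNat] at h
    have key : ∀ a b r s w A : ZMod 2, 2 * b - s * (2 * a) + 3 * (2 * r) - s ^ 2 =
      (2 * w) ^ 2 * A → s = 0 := by decide
    exact key _ _ _ _ _ _ h
  have F2 : b - 2 * a * σ + 3 * ρ - 2 * σ ^ 2 = 2 * w ^ 2 * W'.a₂ := by
    apply mul_left_cancel₀ two_ne_zero_padicInt
    linear_combination E2
  have F4 : -(2 * a * b * σ) + 2 * ρ * b - a * (τ + 2 * ρ * σ) + 3 * ρ ^ 2 - 2 * σ * τ =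
      4 * w ^ 4 * W'.a₄ := by
    apply mul_left_cancel₀ (pow_ne_zero 2 two_ne_zero_padicInt)
    linear_combination E4
  have F6 : 2 * b * ρ ^ 2 + 2 * ρ ^ 3 - 2 * a * b * τ - τ ^ 2 - 2 * a * ρ * τ =
      16 * w ^ 6 * W'.a₆ := by
    apply mul_left_cancel₀ (pow_ne_zero 2 two_ne_zero_padicInt)
    linear_combination E6
  have h2 := congrArg PadicInt.toZMod F2
  have h4 := congrArg PadicInt.toZMod F4
  have h6 := congrArg PadicInt.toZMod F6
  simp only [map_add, map_sub, map_mul, map_pow, map_ofNat, map_neg, hb] at h2 h4 h6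
  have k2 : ∀ a σ ρ w A : ZMod 2, 1 - 2 * a * σ + 3 * ρ - 2 * σ ^ 2 = 2 * w ^ 2 * A → ρ = 1 := by
    decide
  have k6 : ∀ a ρ τ w A : ZMod 2, 2 * 1 * ρ ^ 2 + 2 * ρ ^ 3 - 2 * a * 1 * τ - τ ^ 2 -
    2 * a * ρ * τ = 16 * w ^ 6 * A → τ = 0 := by decide
  have k4 : ∀ a σ w A : ZMod 2, -(2 * a * 1 * σ) + 2 * 1 * 1 - a * (0 + 2 * 1 * σ) + 3 * 1 ^ 2 -
    2 * σ * 0 ≠ 4 * w ^ 4 * A := by decide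
  rw [k2 _ _ _ _ _ h2, k6 _ _ _ _ _ h6] at h4
  exact k4 _ _ _ _ h4

/-- At the prime two, the curves of the family with `β = -1` and `8 ∣ α` are reduced. -/
theorem isReducedModel_fourTorsionCurve_neg_one (a : ℤ_[2]) :
    IsReducedModel (fourTorsionCurve (8 * a) (-1)) := by
  intro r s t u W' hu heq
  obtain ⟨w, rfl⟩ := two_dvd_of_mem_maximalIdeal hu
  have E2 := congrArg a₂ heq
  have E3 := congrArg a₃ heq
  have E4 := congrArg a₄ heq
  have E6 := congrArg a₆ heq
  simp only [variableChange_def, fourTorsionCurve, inv_one, Units.val_one, one_pow,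
    one_mul] at E2 E3 E4 E6
  -- Because 8 ∣ α, the a₃ relation gives 4 ∣ t. Then a₄ makes r even, a₂ makes s and ρ = r/2 odd,
  -- and the a₆ relation divided by 4 fails modulo 2.
  obtain ⟨τ, rfl⟩ : ∃ y, t = 4 * y := by
    refine ⟨w ^ 3 * W'.a₃ + a - a * r, ?_⟩
    apply mul_left_cancel₀ two_ne_zero_padicInt
    linear_combination E3
  obtain ⟨ρ, rfl⟩ : ∃ y, r = 2 * y := by
    apply two_dvd_of_toZMod_eq_zero
    have h := congrArg PadicInt.toZMod E4
    simp only [map_add, map_sub, map_mul, map_pow, map_ofNat, map_zero, map_neg, map_one] at h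
    have key : ∀ a r s t w A : ZMod 2, 0 - s * (8 * a * -1) + 2 * r * -1 -
      (4 * t + r * s) * (8 * a) + 3 * r ^ 2 - 2 * s * (4 * t) = (2 * w) ^ 4 * A → r = 0 := by decide
    exact key _ _ _ _ _ _ h
  obtain ⟨σ, hσ⟩ : ∃ y, s - 1 = 2 * y := by
    apply two_dvd_of_toZMod_eq_zero
    have h := congrArg PadicInt.toZMod E2
    simp only [map_add, map_sub, map_mul, map_pow, map_ofNat, map_neg, map_one] at h ⊢
    have key : ∀ a r s w A : ZMod 2, -1 - s * (8 * a) + 3 * (2 * r) - s ^ 2 =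
      (2 * w) ^ 2 * A → s - 1 = 0 := by decide
    exact key _ _ _ _ _ h
  obtain rfl : s = 2 * σ + 1 := by linear_combination hσ
  have F2 : -1 - 4 * a * (2 * σ + 1) + 3 * ρ - 2 * σ ^ 2 - 2 * σ = 2 * w ^ 2 * W'.a₂ := by
    apply mul_left_cancel₀ two_ne_zero_padicInt
    linear_combination E2
  have F6 : -ρ ^ 2 + 2 * ρ ^ 3 + 8 * a * τ - 4 * τ ^ 2 - 16 * a * ρ * τ = 16 * w ^ 6 * W'.a₆ := by
    apply mul_left_cancel₀ (pow_ne_zero 2 two_ne_zero_padicInt)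
    linear_combination E6
  have h2 := congrArg PadicInt.toZMod F2
  have h6 := congrArg PadicInt.toZMod F6
  simp only [map_add, map_sub, map_mul, map_pow, map_ofNat, map_neg, map_one] at h2 h6
  have k2 : ∀ a σ ρ w A : ZMod 2, -1 - 4 * a * (2 * σ + 1) + 3 * ρ - 2 * σ ^ 2 - 2 * σ =
    2 * w ^ 2 * A → ρ = 1 := by decide
  have k6 : ∀ a τ w A : ZMod 2, -1 ^ 2 + 2 * 1 ^ 3 + 8 * a * τ - 4 * τ ^ 2 - 16 * a * 1 * τ ≠
    16 * w ^ 6 * A := by decide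
  rw [k2 _ _ _ _ _ h2] at h6
  exact k6 _ _ _ _ h6

/-- Modulo p, c₄ ≡ α⁴, which is nonzero. -/
theorem isReducedModel_toPadicInt_fourTorsionCurve_of_unit {α β : ℤ} (hα : ¬ (p : ℤ) ∣ α)
    (hβ : (p : ℤ) ∣ β) : IsReducedModel ((fourTorsionCurve α β).toPadicInt p) := by
  apply isReducedModel_toPadicInt_of_c₄
  rw [fourTorsionCurve_c₄]
  intro h
  have hp : Prime (p : ℤ) := Nat.prime_iff_prime_int.mp Fact.out
  refine hα (hp.dvd_of_dvd_pow (n := 4) ?_)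
  have h1 : (p : ℤ) ∣ β * (16 * α ^ 2 - 16 * β) := hβ.mul_right _
  have h2 := dvd_add ((dvd_pow_self _ (by norm_num)).trans h) h1
  convert h2 using 1
  ring

/-- As p ∣ α, c₄ ≡ 16β² modulo p, so p ∣ c₄ forces p ∣ β. Then c₄ ≡ 16β² modulo p³, and p³ ∣ c₄
forces p² ∣ β. -/
theorem isReducedModel_toPadicInt_fourTorsionCurve_of_odd {α β : ℤ} (hp2 : p ≠ 2)
    (hα : (p : ℤ) ∣ α) (hβ : ¬ (p : ℤ) ^ 2 ∣ β) :
    IsReducedModel ((fourTorsionCurve α β).toPadicInt p) := by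
  apply isReducedModel_toPadicInt_of_c₄
  rw [fourTorsionCurve_c₄]
  intro h
  have hp : Prime (p : ℤ) := Nat.prime_iff_prime_int.mp Fact.out
  have hp16 : ¬ (p : ℤ) ∣ 16 := by
    intro h16
    have h16' : p ∣ 2 ^ 4 := by exact_mod_cast h16
    exact hp2 ((Nat.prime_dvd_prime_iff_eq Fact.out Nat.prime_two).mp
      ((Fact.out : p.Prime).dvd_of_dvd_pow h16'))
  obtain ⟨a, rfl⟩ := hα
  have hdvd : ∀ {m : ℕ} (x y : ℤ), (p : ℤ) ^ m ∣ x → (p : ℤ) ^ m ∣ x + 16 * y ^ 2 →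
      (p : ℤ) ^ m ∣ y ^ 2 := by
    intro m x y hx hxy
    exact (IsCoprime.pow_left ((Prime.coprime_iff_not_dvd hp).mpr hp16)).dvd_of_dvd_mul_left
      ((dvd_add_right hx).mp hxy)
  have h1 : (p : ℤ) ∣ β := by
    refine hp.dvd_of_dvd_pow (n := 2) ?_
    have := hdvd (m := 1) (p * (p ^ 3 * a ^ 4 - 16 * p * a ^ 2 * β)) β (by simp)
      (by
        have h' := (pow_dvd_pow (p : ℤ) (show 1 ≤ 4 by norm_num)).trans h
        ring_nf at h' ⊢
        exact h')
    simpa using this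
  obtain ⟨b, rfl⟩ := h1
  have h2 := hdvd (m := 3) (p ^ 3 * (p * a ^ 4 - 16 * a ^ 2 * b)) (p * b) (Dvd.intro _ rfl)
    (by
      have h' := (pow_dvd_pow (p : ℤ) (show 3 ≤ 4 by norm_num)).trans h
      ring_nf at h' ⊢
      exact h')
  apply hβ
  have h3 : (p : ℤ) ∣ b ^ 2 := by
    refine (mul_dvd_mul_iff_left (pow_ne_zero 2 hp.ne_zero)).mp ?_
    ring_nf at h2 ⊢
    exact h2
  rw [pow_two]
  exact mul_dvd_mul_left _ (hp.dvd_of_dvd_pow h3)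

theorem isReducedModel_toPadicInt_fourTorsionCurve_of_sq_not_dvd {α β : ℤ}
    (hα : (p : ℤ) ∣ α) (hβ : (p : ℤ) ∣ β) (hβ2 : ¬ (p : ℤ) ^ 2 ∣ β) :
    IsReducedModel ((fourTorsionCurve α β).toPadicInt p) := by
  by_cases hp2 : p = 2
  · subst hp2
    obtain ⟨a, rfl⟩ := hα
    obtain ⟨b, rfl⟩ := hβ
    rw [toPadicInt_fourTorsionCurve]
    push_cast
    apply isReducedModel_fourTorsionCurve_two
    rw [map_intCast]
    have hb : ¬ ((b : ZMod 2) = 0) := by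
      rw [ZMod.intCast_zmod_eq_zero_iff_dvd]
      intro h
      apply hβ2
      rw [pow_two]
      exact mul_dvd_mul_left _ h
    exact eq_one_of_ne_zero_zmod_two hb
  · exact isReducedModel_toPadicInt_fourTorsionCurve_of_odd p hp2 hα hβ2

end PadicModels

end WeierstrassCurve

namespace WeierstrassCurve

/-! ### From integer models to the global Tamagawa number -/

section IntegerModels

open IsLocalRing

/-- `W` is an equation with integer coefficients for the rational elliptic curve `E`. -/
def IsIntegerModel (W : WeierstrassCurve ℤ) (E : WeierstrassCurve ℚ) : Prop :=
  ∃ C : VariableChange ℚ, C • (W⁄ℚ) = E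

theorem IsIntegerModel.exists_padic {W : WeierstrassCurve ℤ} {E : WeierstrassCurve ℚ}
    (h : IsIntegerModel W E) (p : ℕ) [Fact p.Prime] :
    ∃ C : VariableChange ℚ_[p], C • ((W.toPadicInt p)⁄ℚ_[p]) = E⁄ℚ_[p] := by
  obtain ⟨C, rfl⟩ := h
  refine ⟨C.map (algebraMap ℚ ℚ_[p]), ?_⟩
  rw [baseChange, baseChange, ← map_variableChange, toPadicInt, map_map, baseChange, map_map]
  congr 2

instance isElliptic_baseChange_padic (E : WeierstrassCurve ℚ) [E.IsElliptic] (p : ℕ)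
    [Fact p.Prime] : (E⁄ℚ_[p]).IsElliptic := by
  unfold baseChange
  infer_instance

variable {E : WeierstrassCurve ℚ} [E.IsElliptic] (p : ℕ) [Fact p.Prime]

theorem IsIntegerModel.Δ_ne_zero {W : WeierstrassCurve ℤ} (h : IsIntegerModel W E) : W.Δ ≠ 0 := by
  obtain ⟨C, hC⟩ := h
  intro h0
  apply E.isUnit_Δ.ne_zero
  rw [← hC, variableChange_Δ, baseChange, map_Δ, h0, map_zero, mul_zero]

omit [E.IsElliptic] in
theorem IsIntegerModel.Δ_pos_iff {W : WeierstrassCurve ℤ} (h : IsIntegerModel W E) :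
    0 < E.Δ ↔ 0 < W.Δ := by
  obtain ⟨C, hC⟩ := h
  have hu : (0 : ℚ) < (C.u⁻¹ : ℚˣ) ^ 12 :=
    Even.pow_pos (by decide) (Units.ne_zero _)
  rw [← hC, variableChange_Δ, baseChange, map_Δ, mul_pos_iff_of_pos_left hu]
  simp

theorem IsIntegerModel.not_hasBadReductionAt {W : WeierstrassCurve ℤ} (h : IsIntegerModel W E)
    (hp : ¬ (p : ℤ) ∣ W.Δ) : ¬ E.HasBadReductionAt p := by
  obtain ⟨C, hC⟩ := h.exists_padic p
  rw [HasBadReductionAt, not_not]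
  refine hasGoodReduction_minimal ?_ hC
  rwa [toPadicInt_Δ, intCast_mem_maximalIdeal_iff]

theorem IsIntegerModel.tamagawaNumberAt_eq_one {W : WeierstrassCurve ℤ} (h : IsIntegerModel W E)
    (hp : ¬ (p : ℤ) ^ 2 ∣ W.Δ) : E.tamagawaNumberAt p = 1 := by
  obtain ⟨C, hC⟩ := h.exists_padic p
  refine localTamagawaNumber_eq_one ?_ hC
  rwa [toPadicInt_Δ, intCast_mem_maximalIdeal_pow_iff]

theorem hasBadReductionAt_of_tamagawaNumberAt_ne_one (h : E.tamagawaNumberAt p ≠ 1) :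
    E.HasBadReductionAt p :=
  fun hgood => h (localTamagawaNumber_eq_one_of_hasGoodReduction hgood)

theorem two_dvd_tamagawaNumberAt {α β : ℤ}
    (hE : IsIntegerModel (fourTorsionCurve α β) E)
    (hred : IsReducedModel ((fourTorsionCurve α β).toPadicInt p)) (hp : (p : ℤ) ∣ α) :
    2 ∣ E.tamagawaNumberAt p := by
  have hΔ := hE.Δ_ne_zero
  rw [fourTorsionCurve_Δ] at hΔ
  have hα : α ≠ 0 := by rintro rfl; simp at hΔ
  have hβ : β ≠ 0 := by rintro rfl; simp at hΔ
  obtain ⟨C, hC⟩ := hE.exists_padic p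
  rw [toPadicInt_fourTorsionCurve] at hred hC
  exact two_dvd_localTamagawaNumber_fourTorsionCurve (by exact_mod_cast hα)
    (by exact_mod_cast hβ) hred ((intCast_mem_maximalIdeal_iff p α).mpr hp) hC

theorem four_dvd_tamagawaNumberAt {α β : ℤ}
    (hE : IsIntegerModel (fourTorsionCurve α β) E)
    (hred : IsReducedModel ((fourTorsionCurve α β).toPadicInt p)) (hp : (p : ℤ) ∣ β) :
    4 ∣ E.tamagawaNumberAt p := by
  have hΔ := hE.Δ_ne_zero
  rw [fourTorsionCurve_Δ] at hΔ
  have hα : α ≠ 0 := by rintro rfl; simp at hΔ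
  have hβ : β ≠ 0 := by rintro rfl; simp at hΔ
  obtain ⟨C, hC⟩ := hE.exists_padic p
  rw [toPadicInt_fourTorsionCurve] at hred hC
  exact four_dvd_localTamagawaNumber_fourTorsionCurve (by exact_mod_cast hα)
    (by exact_mod_cast hβ) hred ((intCast_mem_maximalIdeal_iff p β).mpr hp) hC

/-- `finprod` defaults to 1 on infinite support, so a factor is known to divide it only once the bad
primes are finite in number; they all divide the discriminant of W. -/
theorem IsIntegerModel.finite_bad {W : WeierstrassCurve ℤ} (h : IsIntegerModel W E) :
    Finite {p : Nat.Primes // haveI := Fact.mk p.2; E.HasBadReductionAt p} := by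
  have hfin : (W.Δ.natAbs.primeFactors : Set ℕ).Finite := Finset.finite_toSet _
  have hinj : Function.Injective
      (fun q : {p : Nat.Primes // haveI := Fact.mk p.2; E.HasBadReductionAt p} =>
        (⟨(q.1 : ℕ), by
          have := Fact.mk q.1.2
          have hq := q.2
          have hd : (q.1 : ℤ) ∣ W.Δ := by
            by_contra hn
            exact h.not_hasBadReductionAt q.1 hn hq
          simp only [Finset.mem_coe, Nat.mem_primeFactors]
          exact ⟨q.1.2, Int.natCast_dvd.mp hd, Int.natAbs_ne_zero.mpr h.Δ_ne_zero⟩⟩ :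
          (W.Δ.natAbs.primeFactors : Set ℕ))) := by
    intro a b hab
    simp only [Subtype.mk.injEq] at hab
    exact Subtype.ext (Subtype.ext hab)
  have := hfin.to_subtype
  exact Finite.of_injective _ hinj

theorem dvd_finprod {ι M : Type*} [CommMonoid M] [Finite ι] (f : ι → M) (i : ι) :
    f i ∣ ∏ᶠ j, f j := by
  have := Fintype.ofFinite ι
  rw [finprod_eq_prod_of_fintype]
  exact Finset.dvd_prod_of_mem f (Finset.mem_univ i)

theorem IsIntegerModel.dvd_tamagawaNumber {W : WeierstrassCurve ℤ} (h : IsIntegerModel W E)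
    {n : ℕ} (hn : n ≠ 1) (hd : n ∣ E.tamagawaNumberAt p) : n ∣ E.tamagawaNumber := by
  have := h.finite_bad
  have hbad : E.HasBadReductionAt p :=
    hasBadReductionAt_of_tamagawaNumberAt_ne_one p fun h1 => hn (Nat.dvd_one.mp (h1 ▸ hd))
  exact hd.trans (dvd_finprod _ (⟨⟨p, Fact.out⟩, hbad⟩ :
    {p : Nat.Primes // haveI := Fact.mk p.2; E.HasBadReductionAt p}))

omit [E.IsElliptic] in
theorem tamagawaNumber_eq_one
    (h : ∀ (q : ℕ) [Fact q.Prime], E.tamagawaNumberAt q = 1) : E.tamagawaNumber = 1 := by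
  unfold tamagawaNumber
  exact finprod_eq_one_of_forall_eq_one fun q => by
    have := Fact.mk q.1.2
    exact h q.1

theorem tamagawaNumber_eq_tamagawaNumberAt
    (h : ∀ (q : ℕ) [Fact q.Prime], q ≠ p → E.tamagawaNumberAt q = 1) :
    E.tamagawaNumber = E.tamagawaNumberAt p := by
  -- If c_p = 1, then p may have good reduction and be missing from the index set.
  by_cases hp : E.tamagawaNumberAt p = 1
  · rw [hp]
    refine tamagawaNumber_eq_one fun q _ => ?_
    by_cases hq : q = p
    · subst hq
      convert hp
    · exact h q hq
  · unfold tamagawaNumber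
    refine (finprod_eq_single _ ⟨⟨p, Fact.out⟩,
      hasBadReductionAt_of_tamagawaNumberAt_ne_one p hp⟩ ?_).trans ?_
    · intro q hq
      have := Fact.mk q.1.2
      refine h q.1 fun hqp => hq (Subtype.ext (Subtype.ext hqp))
    · rfl

end IntegerModels

end WeierstrassCurve

namespace WeierstrassCurve

/-! ### Divisibility by four outside the exceptional curves -/

section Global

open IsLocalRing

variable {E : WeierstrassCurve ℚ}

theorem isIntegerModel_fourTorsionCurve {b : ℚ} {C : VariableChange ℚ}
    (hC : C • E = fourTorsionCurve 1 b) {α β : ℤ} (hα : α ≠ 0) (hβ : (β : ℚ) = α ^ 2 * b) :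
    IsIntegerModel (fourTorsionCurve α β) E := by
  have hα' : (α : ℚ) ≠ 0 := by exact_mod_cast hα
  refine ⟨C⁻¹ * ⟨Units.mk0 _ hα', 0, 0, 0⟩, ?_⟩
  rw [mul_smul, inv_smul_eq_iff, hC, ← variableChange_fourTorsionCurve (Units.mk0 _ hα') 1 b,
    baseChange_fourTorsionCurve]
  congr 2
  simp

theorem IsIntegerModel.trans {W : WeierstrassCurve ℤ} (h : IsIntegerModel W E)
    {X : WeierstrassCurve ℚ} {D : VariableChange ℚ} (hD : D • (W⁄ℚ) = X) : E.IsIsomorphic X := by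
  obtain ⟨C, rfl⟩ := h
  exact ⟨D * C⁻¹, by rw [mul_smul, inv_smul_smul, hD]⟩

theorem IsIsomorphic.isIntegerModel {X : WeierstrassCurve ℚ} (h : E.IsIsomorphic X)
    {W : WeierstrassCurve ℤ} {D : VariableChange ℚ} (hD : D • (W⁄ℚ) = X) : IsIntegerModel W E := by
  obtain ⟨C, hC⟩ := h
  exact ⟨C⁻¹ * D, by rw [mul_smul, hD, ← hC, inv_smul_smul]⟩

theorem IsIntegerModel.of_variableChange {W W' : WeierstrassCurve ℤ} (h : IsIntegerModel W E)
    {D : VariableChange ℚ} (hD : D • (W⁄ℚ) = W'⁄ℚ) : IsIntegerModel W' E := by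
  obtain ⟨C, rfl⟩ := h
  exact ⟨C * D⁻¹, by rw [mul_smul, ← hD, inv_smul_smul]⟩

theorem variableChange_eq_cremona17a4 :
    (⟨1, 0, 0, 1⟩ : VariableChange ℚ) • ((fourTorsionCurve (1 : ℤ) (-1))⁄ℚ) = cremona17a4 := by
  ext <;> norm_num [variableChange_def, baseChange, map, fourTorsionCurve, cremona17a4]

theorem variableChange_eq_cremona15a8 :
    (⟨1, 0, 0, 0⟩ : VariableChange ℚ) • ((fourTorsionCurve (1 : ℤ) 1)⁄ℚ) = cremona15a8 := by
  ext <;> norm_num [variableChange_def, baseChange, map, fourTorsionCurve, cremona15a8]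

theorem variableChange_eq_cremona21a4 :
    (⟨1, -1, -1, 0⟩ : VariableChange ℚ) • ((fourTorsionCurve (3 : ℤ) 1)⁄ℚ) = cremona21a4 := by
  ext <;> norm_num [variableChange_def, baseChange, map, fourTorsionCurve, cremona21a4]

theorem variableChange_eq_cremona24a4 :
    (⟨1, -1, -1, 0⟩ : VariableChange ℚ) • ((fourTorsionCurve (2 : ℤ) 1)⁄ℚ) = cremona24a4 := by
  ext <;> norm_num [variableChange_def, baseChange, map, fourTorsionCurve, cremona24a4]

/-- The scaling by 2 is needed because the source has discriminant 2¹²·15, against 15 for the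
target. -/
theorem variableChange_eq_cremona15a7 :
    (⟨Units.mk0 2 two_ne_zero, -20, -7, 156⟩ : VariableChange ℚ) •
      ((fourTorsionCurve (16 : ℤ) 1)⁄ℚ) = cremona15a7 := by
  ext <;> norm_num [variableChange_def, baseChange, map, fourTorsionCurve, cremona15a7]

theorem hasPointOfOrderFour_of_isIntegerModel {α β : ℤ} (hα : α ≠ 0) (hβ : β ≠ 0)
    (h : IsIntegerModel (fourTorsionCurve α β) E) : E.HasPointOfOrderFour := by
  obtain ⟨C, hC⟩ := h
  rw [baseChange_fourTorsionCurve] at hC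
  subst hC
  obtain ⟨P, hP⟩ := pointVariableChange_surjective C _
    (.some 0 0 (nonsingular_fourTorsionCurve_zero (F := ℚ) (α := algebraMap ℤ ℚ α)
      (β := algebraMap ℤ ℚ β) (by simpa using hα) (by simpa using hβ)))
  refine ⟨P, ?_⟩
  rw [← addOrderOf_injective _ (pointVariableChange_injective C _), hP]
  exact addOrderOf_fourTorsionCurve (by simpa using hα) (by simpa using hβ)

theorem exists_four_nsmul_eq_zero {F : Type*} [Field F] [DecidableEq F] {V : WeierstrassCurve F}
    {D : VariableChange F} {α β : F} (hα : α ≠ 0) (hβ : β ≠ 0) (hr : D.r = 0) (ht : D.t = 0)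
    (hV : D • fourTorsionCurve α β = V) :
    ∃ h0 : V.toAffine.Nonsingular 0 0, 4 • Affine.Point.some 0 0 h0 = 0 := by
  subst hV
  have hn := nonsingular_fourTorsionCurve_zero hα hβ
  have h0 : (D • fourTorsionCurve α β).toAffine.Nonsingular 0 0 := by
    rw [nonsingular_variableChange_iff]
    simpa [hr, ht] using hn
  refine ⟨h0, pointVariableChange_injective D _ ?_⟩
  rw [map_nsmul, map_zero, ← four_nsmul_fourTorsionCurve hα hβ, pointVariableChange_some]
  congr 2 <;> simp [hr, ht]

variable [E.IsElliptic]

/-- For α = 32j the equation is not minimal at 2. The substitution with u = 2, s = 1 fixes the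
origin and gives odd c₄, with a₃ = 4j and a₄ = -2j even, so the origin stays singular modulo 2. At α
= 16 (j = 1/2) the same a₄ would be odd. -/
theorem two_dvd_tamagawaNumberAt_two {j : ℤ}
    (hE : IsIntegerModel (fourTorsionCurve (32 * j) 1) E) : 2 ∣ E.tamagawaNumberAt 2 := by
  have hΔ := hE.Δ_ne_zero
  rw [fourTorsionCurve_Δ] at hΔ
  have hj : j ≠ 0 := by rintro rfl; simp at hΔ
  obtain ⟨W, hW⟩ : ∃ W : WeierstrassCurve ℤ, W = ⟨1 + 16 * j, -8 * j, 4 * j, -2 * j, 0⟩ := ⟨_, rfl⟩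
  have hred : IsReducedModel (W.toPadicInt 2) := by
    apply isReducedModel_toPadicInt_of_c₄
    have hc : W.c₄ = 2 * (32768 * j ^ 4 - 512 * j ^ 2) + 1 := by
      simp only [hW, c₄, b₂, b₄]
      ring
    intro h
    have h2 : (2 : ℤ) ∣ W.c₄ := (dvd_pow_self _ (by norm_num)).trans h
    omega
  have hD : ∀ (F : Type) [Field F] [CharZero F],
      (⟨Units.mk0 2 two_ne_zero, 0, 1, 0⟩ : VariableChange F) •
        fourTorsionCurve (32 * (j : F)) 1 = W.map (Int.castRingHom F) := by
    intro F _ _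
    ext <;> simp only [variableChange_def, fourTorsionCurve, hW, map, Units.val_inv_eq_inv_val,
      Units.val_mk0, eq_intCast] <;> push_cast <;> field_simp <;> ring
  have hE' : IsIntegerModel W E := by
    refine hE.of_variableChange (D := ⟨Units.mk0 2 two_ne_zero, 0, 1, 0⟩) ?_
    rw [baseChange_fourTorsionCurve, map_mul, map_ofNat, map_one]
    exact hD ℚ
  classical
  obtain ⟨C, hC⟩ := hE'.exists_padic 2
  have hmap : (W.toPadicInt 2)⁄ℚ_[2] = W.map (Int.castRingHom ℚ_[2]) := by
    rw [baseChange, toPadicInt, map_map]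
    congr 1
  have hj' : (32 * (j : ℚ_[2])) ≠ 0 := mul_ne_zero (by norm_num) (by exact_mod_cast hj)
  obtain ⟨h0, h4⟩ := exists_four_nsmul_eq_zero hj' one_ne_zero rfl rfl ((hD ℚ_[2]).trans hmap.symm)
  refine two_dvd_localTamagawaNumber hred ?_ ?_ (h0 := h0) ?_ hC
  · have : (W.toPadicInt 2).a₃ = ((4 * j : ℤ) : ℤ_[2]) := by rw [hW]; rfl
    rw [this, intCast_mem_maximalIdeal_iff]
    exact ⟨2 * j, by push_cast; ring⟩
  · have : (W.toPadicInt 2).a₄ = ((-2 * j : ℤ) : ℤ_[2]) := by rw [hW]; rfl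
    rw [this, intCast_mem_maximalIdeal_iff]
    exact ⟨-j, by push_cast; ring⟩
  · convert h4

theorem exists_two_dvd_tamagawaNumberAt_of_odd_prime {k : ℕ} {β : ℤ} (hβ : β.natAbs = 1)
    {q : ℕ} (hq : q.Prime) (hqk : q ∣ k) (hodd : Odd q)
    (hE : IsIntegerModel (fourTorsionCurve (k : ℤ) β) E) : 2 ∣ E.tamagawaNumber := by
  have := Fact.mk hq
  have hqk' : (q : ℤ) ∣ k := by exact_mod_cast hqk
  refine hE.dvd_tamagawaNumber q (by norm_num) (two_dvd_tamagawaNumberAt q hE ?_ hqk')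
  refine isReducedModel_toPadicInt_fourTorsionCurve_of_odd q ?_ hqk' fun h => ?_
  · rintro rfl
    exact absurd hodd (by decide)
  · rw [← Int.natAbs_dvd_natAbs, hβ, Int.natAbs_pow, Int.natAbs_natCast, Nat.dvd_one] at h
    have := hq.one_lt
    nlinarith

theorem two_dvd_tamagawaNumber_neg_one {k : ℕ} (hk : 2 ≤ k)
    (hE : IsIntegerModel (fourTorsionCurve (k : ℤ) (-1)) E) : 2 ∣ E.tamagawaNumber := by
  rcases Nat.eq_two_pow_or_exists_odd_prime_and_dvd k with ⟨e, he⟩ | ⟨q, hq, hqk, hodd⟩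
  · refine hE.dvd_tamagawaNumber 2 (by norm_num) (two_dvd_tamagawaNumberAt 2 hE ?_ ?_)
    -- For k = 2 and k = 4 the discriminants 80 and 512 are too small for 2¹²; from k = 8 on, 8 ∣ α.
    · rcases lt_or_ge e 3 with h3 | h3
      · apply isReducedModel_toPadicInt_of_Δ
        rw [fourTorsionCurve_Δ, he]
        interval_cases e
        · norm_num at he
          omega
        · norm_num
        · norm_num
      · obtain ⟨i, rfl⟩ := Nat.exists_eq_add_of_le h3
        rw [toPadicInt_fourTorsionCurve]
        convert isReducedModel_fourTorsionCurve_neg_one ((2 : ℤ_[2]) ^ i) using 2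
        · rw [he]
          push_cast
          ring
        · push_cast
          ring
    · have he0 : e ≠ 0 := by
        rintro rfl
        norm_num at he
        omega
      rw [he]
      push_cast
      exact dvd_pow_self _ he0
  · exact exists_two_dvd_tamagawaNumberAt_of_odd_prime rfl hq hqk hodd hE

theorem two_dvd_tamagawaNumber_one {k : ℕ} (hk : 5 ≤ k) (hk16 : k ≠ 16)
    (hE : IsIntegerModel (fourTorsionCurve (k : ℤ) 1) E) : 2 ∣ E.tamagawaNumber := by
  rcases Nat.eq_two_pow_or_exists_odd_prime_and_dvd k with ⟨e, he⟩ | ⟨q, hq, hqk, hodd⟩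
  · refine hE.dvd_tamagawaNumber 2 (by norm_num) ?_
    -- Below 32 only k = 8 is left, with Δ = 3·2¹⁰; from 32 on, the equation must first be made
    -- smaller at 2.
    rcases lt_or_ge e 5 with h5 | h5
    · have he3 : e = 3 := by
        interval_cases e <;> omega
      subst he3
      refine two_dvd_tamagawaNumberAt 2 hE (isReducedModel_toPadicInt_of_Δ 2 ?_) ?_
      · rw [fourTorsionCurve_Δ, he]
        norm_num
      · rw [he]
        norm_num
    · obtain ⟨i, rfl⟩ := Nat.exists_eq_add_of_le h5
      refine two_dvd_tamagawaNumberAt_two (j := 2 ^ i) ?_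
      convert hE using 2
      rw [he]
      push_cast
      ring
  · exact exists_two_dvd_tamagawaNumberAt_of_odd_prime rfl hq hqk hodd hE

omit [E.IsElliptic] in
theorem four_dvd_of_two_dvd {W : WeierstrassCurve ℤ} (hE : IsIntegerModel W E) (hΔ : 0 < W.Δ)
    (h : 2 ∣ E.tamagawaNumber) : 4 ∣ E.tamagawaNumber * E.tamagawaNumberAtInfinity := by
  rw [tamagawaNumberAtInfinity, if_pos (hE.Δ_pos_iff.mpr hΔ)]
  exact mul_dvd_mul_right h 2

theorem four_dvd_tamagawaNumber_mul (h4 : E.HasPointOfOrderFour) (hex : ¬ E.IsExceptional) :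
    4 ∣ E.tamagawaNumber * E.tamagawaNumberAtInfinity := by
  obtain ⟨P, hP⟩ := h4
  obtain ⟨C, b, hb, hC⟩ := exists_variableChange_eq_fourTorsionCurve E hP
  by_cases hnum : b.num.natAbs = 1
  -- Here b = ±1/(k²d) with d squarefree; the primes dividing d are those of odd exponent in the
  -- denominator.
  · obtain ⟨d, k, hdk, hsq⟩ := Nat.sq_mul_squarefree b.den
    have hk0 : k ≠ 0 := by
      rintro rfl
      exact b.den_ne_zero (by simpa using hdk.symm)
    have hd0 : d ≠ 0 := hsq.ne_zero
    have hsign : (b.num : ℤ) * b.num = 1 := by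
      rcases Int.natAbs_eq_iff.mp hnum with h | h <;> rw [h] <;> norm_num
    have hbden : b * ((k : ℚ) ^ 2 * d) = b.num := by
      have : ((k : ℚ) ^ 2 * d) = b.den := by exact_mod_cast hdk
      rw [this, Rat.mul_den_eq_num]
    by_cases hd1 : d = 1
    · have hmodel : IsIntegerModel (fourTorsionCurve (k : ℤ) b.num) E := by
        refine isIntegerModel_fourTorsionCurve hC (by exact_mod_cast hk0) ?_
        rw [← hbden, hd1]
        push_cast
        ring
      rcases Int.natAbs_eq_iff.mp hnum with h | h
      · rw [h] at hmodel
        have hΔ := hmodel.Δ_ne_zero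
        rw [fourTorsionCurve_Δ] at hΔ
        by_cases hk5 : 5 ≤ k
        · by_cases hk16 : k = 16
          · subst hk16
            exact absurd (Or.inl (hmodel.trans variableChange_eq_cremona15a7)) hex
          · refine four_dvd_of_two_dvd hmodel ?_ (two_dvd_tamagawaNumber_one hk5 hk16 hmodel)
            rw [fourTorsionCurve_Δ]
            have : (5 : ℤ) ≤ k := by exact_mod_cast hk5
            have h1 : (0 : ℤ) < (k : ℤ) ^ 2 - 16 * (1 : ℕ) := by push_cast; nlinarith
            positivity
        · push Not at hk5
          interval_cases k
          · exact absurd rfl hk0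
          · exact absurd (Or.inr (Or.inl (hmodel.trans variableChange_eq_cremona15a8))) hex
          · exact absurd (Or.inr (Or.inr (Or.inr (Or.inr
              (hmodel.trans variableChange_eq_cremona24a4))))) hex
          · exact absurd (Or.inr (Or.inr (Or.inr (Or.inl
              (hmodel.trans variableChange_eq_cremona21a4))))) hex
          -- k = 4, β = 1 gives Δ = 0.
          · norm_num at hΔ
      · rw [h] at hmodel
        by_cases hk1 : k = 1
        · subst hk1
          exact absurd (Or.inr (Or.inr (Or.inl (hmodel.trans variableChange_eq_cremona17a4)))) hex
        · refine four_dvd_of_two_dvd hmodel ?_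
            (two_dvd_tamagawaNumber_neg_one (by omega) hmodel)
          rw [fourTorsionCurve_Δ]
          push_cast
          have : (0 : ℤ) < k := by positivity
          nlinarith [pow_pos this 2, pow_pos this 4]
    -- Taking α = dk gives β = ±d, which p divides exactly once.
    · obtain ⟨p, hp, hpd⟩ := Nat.exists_prime_and_dvd hd1
      have := Fact.mk hp
      have hmodel : IsIntegerModel (fourTorsionCurve ((d : ℤ) * k) (b.num * d)) E := by
        refine isIntegerModel_fourTorsionCurve hC
          (mul_ne_zero (by exact_mod_cast hd0) (by exact_mod_cast hk0)) ?_
        push_cast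
        rw [← hbden]
        ring
      have hpd' : (p : ℤ) ∣ d := by exact_mod_cast hpd
      have h2 : ¬ (p : ℤ) ^ 2 ∣ b.num * d := by
        intro h
        rw [← Int.natAbs_dvd_natAbs, Int.natAbs_mul, hnum, one_mul, Int.natAbs_pow,
          Int.natAbs_natCast, Int.natAbs_natCast, pow_two] at h
        exact hp.one_lt.ne' (Nat.isUnit_iff.mp (hsq p h))
      exact Dvd.dvd.mul_right (hmodel.dvd_tamagawaNumber p (by norm_num)
        (four_dvd_tamagawaNumberAt p hmodel
          (isReducedModel_toPadicInt_fourTorsionCurve_of_sq_not_dvd p (hpd'.mul_right _)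
            (hpd'.mul_left _) h2) (hpd'.mul_left _))) _
  -- Taking α to be the denominator keeps α prime to p, while p divides β.
  · obtain ⟨p, hp, hpm⟩ := Nat.exists_prime_and_dvd hnum
    have := Fact.mk hp
    have hpm' : (p : ℤ) ∣ b.num := Int.natCast_dvd.mpr hpm
    have hmodel : IsIntegerModel (fourTorsionCurve (b.den : ℤ) (b.num * b.den)) E := by
      refine isIntegerModel_fourTorsionCurve hC (by exact_mod_cast b.den_ne_zero) ?_
      push_cast
      rw [← Rat.mul_den_eq_num]
      ring
    have hden : ¬ (p : ℤ) ∣ b.den := by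
      intro h
      have h' : p ∣ b.den := by exact_mod_cast h
      have := Nat.dvd_gcd hpm h'
      rw [b.reduced.gcd_eq_one] at this
      exact hp.one_lt.ne' (Nat.dvd_one.mp this)
    exact Dvd.dvd.mul_right (hmodel.dvd_tamagawaNumber p (by norm_num)
      (four_dvd_tamagawaNumberAt p hmodel
        (isReducedModel_toPadicInt_fourTorsionCurve_of_unit p hden (hpm'.mul_right _))
        (hpm'.mul_right _))) _

end Global

end WeierstrassCurve

namespace WeierstrassCurve

/-! ### The five exceptional curves -/

section Exceptional

open IsLocalRing

variable {E : WeierstrassCurve ℚ}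

theorem not_sq_dvd_of_squarefree {q : ℕ} (hq : q.Prime) {m : ℤ} (hm : Squarefree m.natAbs) :
    ¬ (q : ℤ) ^ 2 ∣ m := by
  intro h
  rw [← Int.natAbs_dvd_natAbs, Int.natAbs_pow, Int.natAbs_natCast, pow_two] at h
  exact hq.one_lt.ne' (Nat.isUnit_iff.mp (hm q h))

theorem not_sq_dvd_pow_mul {p q : ℕ} (hp : p.Prime) (hq : q.Prime) (hqp : q ≠ p) (n : ℕ) {m : ℤ}
    (hm : Squarefree m.natAbs) : ¬ (q : ℤ) ^ 2 ∣ (p : ℤ) ^ n * m := by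
  intro h
  refine not_sq_dvd_of_squarefree hq hm (IsCoprime.dvd_of_dvd_mul_left (IsCoprime.pow ?_) h)
  exact Nat.isCoprime_iff_coprime.mpr ((Nat.coprime_primes hq hp).mpr hqp)

theorem squarefree_fifteen : Squarefree 15 :=
  (Nat.squarefree_mul (m := 3) (n := 5) (by norm_num)).mpr
    ⟨Nat.prime_three.squarefree, Nat.prime_five.squarefree⟩

theorem not_four_dvd_tamagawaNumberAtInfinity : ¬ 4 ∣ E.tamagawaNumberAtInfinity := by
  unfold tamagawaNumberAtInfinity
  split_ifs <;> norm_num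

variable [E.IsElliptic]

theorem not_four_dvd_of_squarefree_Δ {W : WeierstrassCurve ℤ} (hE : IsIntegerModel W E)
    (hΔ : Squarefree W.Δ.natAbs) : ¬ 4 ∣ E.tamagawaNumber * E.tamagawaNumberAtInfinity := by
  rw [tamagawaNumber_eq_one fun q hq =>
    hE.tamagawaNumberAt_eq_one q (not_sq_dvd_of_squarefree hq.out hΔ), one_mul]
  exact not_four_dvd_tamagawaNumberAtInfinity

/-- As m is squarefree, every prime other than p contributes 1, and m ≤ 0 gives c_∞ = 1. The bound n
< 12 makes the equation reduced at p, so everything rests on c_p. -/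
theorem not_four_dvd_of_fourTorsionCurve_prime_one (p : ℕ) [Fact p.Prime]
    (hE : IsIntegerModel (fourTorsionCurve (p : ℤ) 1) E) {n : ℕ} (hn : n < 12) {m : ℤ}
    (hΔ : (fourTorsionCurve (p : ℤ) 1).Δ = (p : ℤ) ^ n * m) (hm : Squarefree m.natAbs)
    (hpm : ¬ (p : ℤ) ∣ m) (hm0 : m ≤ 0)
    (hsing : ∀ x y : ℤ_[p], (fourTorsionCurve (p : ℤ_[p]) 1).toAffine.Equation x y →
      (p : ℤ_[p]) ∣ p * y - (3 * x ^ 2 + 2 * x) → (p : ℤ_[p]) ∣ 2 * y + p * x + p →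
        (p : ℤ_[p]) ∣ x ∧ (p : ℤ_[p]) ∣ y) :
    ¬ 4 ∣ E.tamagawaNumber * E.tamagawaNumberAtInfinity := by
  have hp0 : (p : ℤ) ≠ 0 := by exact_mod_cast (Fact.out : p.Prime).ne_zero
  have hinf : E.tamagawaNumberAtInfinity = 1 := by
    rw [tamagawaNumberAtInfinity, if_neg]
    rw [hE.Δ_pos_iff, hΔ, not_lt]
    exact mul_nonpos_of_nonneg_of_nonpos (by positivity) hm0
  rw [hinf, mul_one, tamagawaNumber_eq_tamagawaNumberAt p fun q hq hqp =>
    hE.tamagawaNumberAt_eq_one q (hΔ ▸ not_sq_dvd_pow_mul Fact.out hq.out hqp n hm)]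
  obtain ⟨C, hC⟩ := hE.exists_padic p
  have hred : IsReducedModel ((fourTorsionCurve (p : ℤ) 1).toPadicInt p) := by
    apply isReducedModel_toPadicInt_of_Δ
    rw [hΔ]
    intro h
    have h1 := (pow_dvd_pow (p : ℤ) (Nat.succ_le_of_lt hn)).trans h
    rw [pow_succ] at h1
    exact hpm ((mul_dvd_mul_iff_left (pow_ne_zero n hp0)).mp h1)
  rw [toPadicInt_fourTorsionCurve, Int.cast_natCast, Int.cast_one] at hred hC
  exact not_four_dvd_localTamagawaNumber PadicInt.maximalIdeal_eq_span_p
    (by exact_mod_cast (Fact.out : p.Prime).ne_zero) hred hsing hC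

theorem not_four_dvd_of_model_two (hE : IsIntegerModel (fourTorsionCurve (2 : ℤ) 1) E) :
    ¬ 4 ∣ E.tamagawaNumber * E.tamagawaNumberAtInfinity := by
  refine not_four_dvd_of_fourTorsionCurve_prime_one 2 (by exact_mod_cast hE) (n := 4) (m := -3) (by norm_num)
    (by rw [fourTorsionCurve_Δ]; norm_num) (by simpa using Nat.prime_three.squarefree) (by norm_num)
    (by norm_num) ?_
  intro x y hxy hX _
  have hp : Prime ((2 : ℕ) : ℤ_[2]) := PadicInt.prime_p
  push_cast at hp hX hxy ⊢
  -- The x-derivative is x² modulo 2; for even x the curve equation then gives 2 ∣ y².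
  have hx : (2 : ℤ_[2]) ∣ x := by
    refine hp.dvd_of_dvd_pow (n := 2) ?_
    obtain ⟨c, hc⟩ := hX
    exact ⟨y - x ^ 2 - x - c, by linear_combination -hc⟩
  refine ⟨hx, hp.dvd_of_dvd_pow (n := 2) ?_⟩
  obtain ⟨d, rfl⟩ := hx
  rw [Affine.equation_iff] at hxy
  simp only [fourTorsionCurve] at hxy
  exact ⟨4 * d ^ 3 + 2 * d ^ 2 - 2 * d * y - y, by linear_combination hxy⟩

theorem not_four_dvd_of_model_three (hE : IsIntegerModel (fourTorsionCurve (3 : ℤ) 1) E) :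
    ¬ 4 ∣ E.tamagawaNumber * E.tamagawaNumberAtInfinity := by
  refine not_four_dvd_of_fourTorsionCurve_prime_one 3 (by exact_mod_cast hE) (n := 2) (m := -7) (by norm_num)
    (by rw [fourTorsionCurve_Δ]; norm_num)
    (by simpa using (by norm_num : Nat.Prime 7).squarefree) (by norm_num) (by norm_num) ?_
  intro x y _ hX hY
  push_cast at hX hY ⊢
  obtain ⟨c, hc⟩ := hX
  obtain ⟨d, hd⟩ := hY
  exact ⟨⟨x + c - y + x ^ 2, by linear_combination hc⟩,
    ⟨y + x + 1 - d, by linear_combination -hd⟩⟩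

theorem hasPointOfOrderFour_and_not_four_dvd (h : E.IsExceptional) :
    E.HasPointOfOrderFour ∧ ¬ 4 ∣ E.tamagawaNumber * E.tamagawaNumberAtInfinity := by
  rcases h with h | h | h | h | h
  · refine ⟨hasPointOfOrderFour_of_isIntegerModel (by norm_num) (by norm_num)
      (h.isIntegerModel variableChange_eq_cremona15a7), ?_⟩
    -- The four-torsion equation has discriminant 2¹²·15, so Cremona's equation, of squarefree
    -- discriminant 15, is used.
    refine not_four_dvd_of_squarefree_Δ
      (h.isIntegerModel (W := ⟨1, 1, 1, -80, 242⟩) (D := 1) ?_) ?_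
    · rw [one_smul]
      ext <;> simp [baseChange, map, cremona15a7]
    · norm_num [Δ, b₂, b₄, b₆, b₈]
      exact squarefree_fifteen
  · have hE := h.isIntegerModel variableChange_eq_cremona15a8
    refine ⟨hasPointOfOrderFour_of_isIntegerModel (by norm_num) (by norm_num) hE,
      not_four_dvd_of_squarefree_Δ hE ?_⟩
    rw [fourTorsionCurve_Δ]
    norm_num
    exact squarefree_fifteen
  · have hE := h.isIntegerModel variableChange_eq_cremona17a4
    refine ⟨hasPointOfOrderFour_of_isIntegerModel (by norm_num) (by norm_num) hE,
      not_four_dvd_of_squarefree_Δ hE ?_⟩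
    rw [fourTorsionCurve_Δ]
    norm_num
    exact (by norm_num : Nat.Prime 17).squarefree
  · have hE := h.isIntegerModel variableChange_eq_cremona21a4
    exact ⟨hasPointOfOrderFour_of_isIntegerModel (by norm_num) (by norm_num) hE,
      not_four_dvd_of_model_three hE⟩
  · have hE := h.isIntegerModel variableChange_eq_cremona24a4
    exact ⟨hasPointOfOrderFour_of_isIntegerModel (by norm_num) (by norm_num) hE,
      not_four_dvd_of_model_two hE⟩

end Exceptional

end WeierstrassCurve

theorem proposition2p1 (E : WeierstrassCurve ℚ) [E.IsElliptic] :
    (E.HasPointOfOrderFour → ¬ E.IsExceptional →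
      4 ∣ E.tamagawaNumber * E.tamagawaNumberAtInfinity) ∧
    (E.IsExceptional →
      E.HasPointOfOrderFour ∧ ¬ 4 ∣ E.tamagawaNumber * E.tamagawaNumberAtInfinity) :=
  ⟨WeierstrassCurve.four_dvd_tamagawaNumber_mul,
    WeierstrassCurve.hasPointOfOrderFour_and_not_four_dvd⟩
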